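/- Let $q\ge 1$ and let $T$ be a $q\times q$ matrix with entries in $\{0,1\}$ that is primitive, i.e. some power $T^k$, $k\ge1$, has only positive entries. Let $\Sigma_T=\{x\in\{1,\dots,q\}^{\mathbb N_0}: T_{x_i,x_{i+1}}=1\ \forall i\ge 0\}$, with the product topology, be the one-sided subshift of finite type, and let $\sigma:\Sigma_T\to\Sigma_T$ be the left shift. Let $\mathcal C_n$ be the set of words $I=(i_0,\dots,i_{n-1})\in\{1,\dots,q\}^n$ with $T_{i_j,i_{j+1}}=1$ for $0\le j\le n-2$, and $[I]=\{x\in\Sigma_T: x_j=i_j,\ 0\le j\le n-1\}$. Let $\Phi=(\varphi_n)_{n\ge1}$ be a superadditive sequence of potentials, i.e. each $\varphi_n:\Sigma_T\to\mathbb R$ is continuous and $\varphi_{n+m}(x)\ge\varphi_n(x)+\varphi_m(\sigma^n x)$ for all $n,m\ge1$ and $x\in\Sigma_T$. Then the limits $$P_{\mathrm{top}}(\Phi,\sigma)=\lim_{n\to\infty}\frac1n\log\sum_{I\in\mathcal C_n}e^{\inf_{x\in[I]}\varphi_n(x)},\qquad \Phi_*(\mu)=\lim_{n\to\infty}\frac1n\int\varphi_n\,d\mu$$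 exist in $[-\infty,\infty]$ (possibly $+\infty$), the latter for every $\sigma$-invariant Borel probability measure $\mu$ on $\Sigma_T$, and $$P_{\mathrm{top}}(\Phi,\sigma)=\sup\{h(\mu,\sigma)+\Phi_*(\mu):\mu\text{ a }\sigma\text{-invariant Borel probability measure on }\Sigma_T\},$$ where $h(\mu,\sigma)$ is the Kolmogorov–Sinai entropy of $\mu$ with respect to $\sigma$; both sides may be $+\infty$. -/

import Mathlib

open Filter Topology MeasureTheory

namespace SFT

/-- The one-sided subshift of finite type `Σ_T ⊆ {1, …, q}^{ℕ₀}` with adjacency matrix `T`.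
As a subtype it carries the product topology of the discrete topology on the alphabet (this is
also the topology of the metric `d(x, y) = 2^{-min {k : x_k ≠ y_k}}`) and the corresponding
Borel σ-algebra. -/
def shiftSpace {q : ℕ} (T : Matrix (Fin q) (Fin q) ℤ) : Set (ℕ → Fin q) :=
  {x | ∀ i : ℕ, T (x i) (x (i + 1)) = 1}

/-- The left shift `σ` on `Σ_T`. -/
def shift {q : ℕ} (T : Matrix (Fin q) (Fin q) ℤ) (x : shiftSpace T) : shiftSpace T :=
  ⟨fun i => x.1 (i + 1), fun i => x.2 (i + 1)⟩

/-- The admissible words of length `n`. -/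
def IsAdmissible {q : ℕ} (T : Matrix (Fin q) (Fin q) ℤ) {n : ℕ} (w : Fin n → Fin q) : Prop :=
  ∀ (i : ℕ) (h : i + 1 < n), T (w ⟨i, Nat.lt_of_succ_lt h⟩) (w ⟨i + 1, h⟩) = 1

open Classical in
/-- The finite set `𝓒_n` of admissible words of length `n`. -/
noncomputable def words {q : ℕ} (T : Matrix (Fin q) (Fin q) ℤ) (n : ℕ) :
    Finset (Fin n → Fin q) :=
  Finset.univ.filter (fun w => IsAdmissible T w)

/-- The cylinder `[w] ⊆ Σ_T` of a word `w` of length `n`. -/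
def cylinder {q : ℕ} (T : Matrix (Fin q) (Fin q) ℤ) {n : ℕ} (w : Fin n → Fin q) :
    Set (shiftSpace T) :=
  {x | ∀ j : Fin n, x.1 j = w j}

/-- A superadditive sequence of potentials `(φ_n)_{n ≥ 1}` on `Σ_T`: every `φ_n` is continuous and
`φ_{n+m} ≥ φ_n + φ_m ∘ σ^n` for `n, m ≥ 1`. The value of the sequence at `n = 0` plays no role. -/
structure IsSuperadditive {q : ℕ} (T : Matrix (Fin q) (Fin q) ℤ)
    (φ : ℕ → shiftSpace T → ℝ) : Prop where
  continuous : ∀ n : ℕ, 1 ≤ n → Continuous (φ n)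
  superadd : ∀ n m : ℕ, 1 ≤ n → 1 ≤ m → ∀ x : shiftSpace T,
    φ n x + φ m ((shift T)^[n] x) ≤ φ (n + m) x

/-- `∑_{I ∈ 𝓒_n} exp (inf_{x ∈ [I]} φ_n x)`. -/
noncomputable def partitionSum {q : ℕ} (T : Matrix (Fin q) (Fin q) ℤ)
    (φ : ℕ → shiftSpace T → ℝ) (n : ℕ) : ℝ :=
  ∑ w ∈ words T n, Real.exp (sInf (φ n '' cylinder T w))

/-- `(1/n) log ∑_{I ∈ 𝓒_n} exp (inf_{x ∈ [I]} φ_n x)`, as an extended real. -/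
noncomputable def pressureSeq {q : ℕ} (T : Matrix (Fin q) (Fin q) ℤ)
    (φ : ℕ → shiftSpace T → ℝ) (n : ℕ) : EReal :=
  ((Real.log (partitionSum T φ n) / n : ℝ) : EReal)

/-- The topological pressure: the limit of `pressureSeq` in the extended reals, written as a
`limsup` so as to be defined unconditionally. -/
noncomputable def topPressure {q : ℕ} (T : Matrix (Fin q) (Fin q) ℤ)
    (φ : ℕ → shiftSpace T → ℝ) : EReal :=
  limsup (pressureSeq T φ) atTop

/-- `(1/n) ∫ φ_n dμ`, as an extended real. -/
noncomputable def averageSeq {q : ℕ} (T : Matrix (Fin q) (Fin q) ℤ)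
    (φ : ℕ → shiftSpace T → ℝ) (μ : Measure (shiftSpace T)) (n : ℕ) : EReal :=
  (((∫ x, φ n x ∂μ) / n : ℝ) : EReal)

/-- `Φ_*(μ)`: the limit of `averageSeq` in the extended reals, written as a `limsup` so as to be
defined unconditionally. -/
noncomputable def asymptoticAverage {q : ℕ} (T : Matrix (Fin q) (Fin q) ℤ)
    (φ : ℕ → shiftSpace T → ℝ) (μ : Measure (shiftSpace T)) : EReal :=
  limsup (averageSeq T φ μ) atTop

/-- The set of shift-invariant Borel probability measures on `Σ_T`. -/
def invariantMeasures {q : ℕ} (T : Matrix (Fin q) (Fin q) ℤ) : Set (Measure (shiftSpace T)) :=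
  {μ | IsProbabilityMeasure μ ∧ MeasurePreserving (shift T) μ μ}

/-- Shannon entropy `-∑_a μ(f = a) log μ(f = a)` of the finite partition `{f = a}_{a ∈ A}`. -/
noncomputable def shannonEntropy {X A : Type*} [MeasurableSpace X] [Fintype A]
    (μ : Measure X) (f : X → A) : ℝ :=
  ∑ a : A, Real.negMulLog (μ.real (f ⁻¹' {a}))

/-- Entropy of `S` relative to the finite partition `ξ` given by the fibres of `f`: the limit of
`(1/n) H_μ(ξ ∨ S⁻¹ξ ∨ … ∨ S^{-(n-1)}ξ)`, which exists for `S`-invariant `μ`. -/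
noncomputable def partitionEntropy {X A : Type*} [MeasurableSpace X] [Fintype A]
    (μ : Measure X) (S : X → X) (f : X → A) : EReal :=
  limsup (fun n : ℕ =>
    ((shannonEntropy μ (fun x => fun j : Fin n => f (S^[j] x)) / n : ℝ) : EReal)) atTop

/-- Kolmogorov–Sinai entropy: the supremum of the entropies over all finite measurable
partitions, a partition into (at most) `k` cells being given by a measurable map to `Fin k`. -/
noncomputable def entropy {X : Type*} [MeasurableSpace X] (μ : Measure X) (S : X → X) : EReal :=
  ⨆ (k : ℕ) (f : X → Fin k) (_ : Measurable f), partitionEntropy μ S f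

/-- The measure-theoretic pressure `sup {h(μ, σ) + Φ_*(μ) : μ shift-invariant}`. -/
noncomputable def measPressure {q : ℕ} (T : Matrix (Fin q) (Fin q) ℤ)
    (φ : ℕ → shiftSpace T → ℝ) : EReal :=
  ⨆ μ ∈ invariantMeasures T, (entropy μ (shift T) + asymptoticAverage T φ μ)

end SFT

/-! Primitivity gives a `k` such that any two letters are joined by an admissible path with `k`
letters in between, and superadditivity gives `φ_n ≥ -C n`. Gluing words across gaps of length `k`
makes `log Z_n`, with `Z_n` the partition sum, superadditive up to the gap and the loss `C k`. By
Fekete's lemma the pressure is therefore the supremum of `(log Z_n - C k) / (n + k)`, and the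
averages `(1/n) ∫ φ_n dμ` likewise converge to their supremum. Both halves of the variational
principle are comparisons with these suprema, so the value `+∞` needs no separate construction.

Upper bound (`entropy_add_asymptoticAverage_le`): Gibbs' inequality gives `H_μ(𝓒_m) + ∫ inf_{[x_0 …
x_{m-1}]} φ_m dμ(x) ≤ log Z_m`. The `φ_m` have no uniform distortion bound, so the infimum is
bounded below by a Birkhoff sum of one fixed `φ_M` along multiples of `M`, and only the uniform
continuity of `φ_M` enters. This yields `h(μ) ≤ P - (1/M) ∫ φ_M dμ` for every `M`. General
partitions reduce to cylinders by approximation (`exists_shannonEntropy_itinerary_le`).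

Lower bound (`exists_invariant_free_energy_ge`): for each `n`, choose words of length `n`
independently with probabilities `exp (inf φ_n) / Z_n`, join them by connecting paths, and average
the resulting law over `n + k` shifts. The invariant measure so obtained has free energy at least
`(log Z_n - C k) / (n + k)`. No limit of measures and no semicontinuity of entropy is needed. -/

namespace SFT

/-! ### Fekete's lemma with a gap -/

/-- Iterating almost superadditivity. -/
theorem mul_add_le_of_superadditive_gap {u : ℕ → ℝ} {k : ℕ} {D : ℝ}
    (h : ∀ n m, 1 ≤ n → 1 ≤ m → u n + u m - D ≤ u (n + k + m)) {m r : ℕ} (hm : 1 ≤ m)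
    (hr : 1 ≤ r) (t : ℕ) : t * (u m - D) + u r ≤ u (t * (m + k) + r) := by
  induction t with
  | zero => simp
  | succ t ih =>
    have h1 := h m (t * (m + k) + r) hm (by omega)
    have h2 : m + k + (t * (m + k) + r) = (t + 1) * (m + k) + r := by ring
    rw [h2] at h1
    push_cast
    linarith

theorem exists_lower_bound_of_superadditive_gap {u : ℕ → ℝ} {k : ℕ} {D : ℝ}
    (h : ∀ n m, 1 ≤ n → 1 ≤ m → u n + u m - D ≤ u (n + k + m)) {m : ℕ} (hm : 1 ≤ m) :
    ∃ B : ℝ, ∀ n : ℕ, 1 ≤ n → (u m - D) / (m + k) - B / n ≤ u n / n := by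
  have hL : (0 : ℝ) < m + k := by
    have : (1 : ℝ) ≤ m := by exact_mod_cast hm
    positivity
  refine ⟨|u m - D| + ∑ r ∈ Finset.range (m + k + 1), |u r|, fun n hn => ?_⟩
  have hn0 : (0 : ℝ) < n := by exact_mod_cast hn
  set t := (n - 1) / (m + k) with ht
  -- Dividing `n - 1` rather than `n` keeps the remainder block nonempty, since the hypothesis
  -- concerns indices `≥ 1` only.
  set r := (n - 1) % (m + k) + 1 with hr
  have hrlt : (n - 1) % (m + k) < m + k := Nat.mod_lt _ (by omega)
  have hdm := Nat.div_add_mod' (n - 1) (m + k)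
  rw [← ht] at hdm
  have hsum : t * (m + k) + r = n := by omega
  have h1 := mul_add_le_of_superadditive_gap h hm (show 1 ≤ r by omega) t
  rw [hsum] at h1
  have h2 : |u r| ≤ ∑ r ∈ Finset.range (m + k + 1), |u r| :=
    Finset.single_le_sum (f := fun r => |u r|) (fun _ _ => abs_nonneg _)
      (Finset.mem_range.2 (by omega))
  have h3 := neg_abs_le (u r)
  have hsum' : (t : ℝ) * (m + k) + r = n := by exact_mod_cast hsum
  have hr1 : (r : ℝ) ≤ m + k := by exact_mod_cast (show r ≤ m + k by omega)
  have hr0 : (0 : ℝ) ≤ r := by positivity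
  have h4 : (n : ℝ) / (m + k) * (u m - D) - |u m - D| ≤ t * (u m - D) := by
    have e : (n : ℝ) / (m + k) = t + r / (m + k) := by
      rw [← hsum']; field_simp
    rw [e]
    have h5 : (r : ℝ) / (m + k) ≤ 1 := (div_le_one hL).2 hr1
    have h6 : (0 : ℝ) ≤ r / (m + k) := by positivity
    have h7 := le_abs_self (u m - D)
    have h8 := abs_nonneg (u m - D)
    nlinarith [mul_le_mul_of_nonneg_left h7 h6, mul_le_mul_of_nonneg_right h5 h8]
  rw [div_sub_div _ _ hL.ne' hn0.ne', div_le_div_iff₀ (by positivity) hn0]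
  have h9 : (n : ℝ) / (m + k) * (u m - D) * (m + k) = n * (u m - D) := by
    field_simp
  have h10 : (n : ℝ) / (m + k) * (u m - D) -
      (|u m - D| + ∑ r ∈ Finset.range (m + k + 1), |u r|) ≤ u n := by linarith
  have h11 := mul_le_mul_of_nonneg_left h10 (mul_nonneg hL.le hn0.le)
  nlinarith [h11, h9]

/-- Fekete's lemma in the extended reals, for sequences that are superadditive up to a gap `k` in
the index and a constant `D`. -/
theorem tendsto_div_of_superadditive_gap {u : ℕ → ℝ} {k : ℕ} {D : ℝ}
    (h : ∀ n m, 1 ≤ n → 1 ≤ m → u n + u m - D ≤ u (n + k + m)) :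
    Tendsto (fun n : ℕ => ((u n / n : ℝ) : EReal)) atTop
      (𝓝 (⨆ (m : ℕ) (_ : 1 ≤ m), (((u m - D) / (m + k) : ℝ) : EReal))) := by
  set S : EReal := ⨆ (m : ℕ) (_ : 1 ≤ m), (((u m - D) / (m + k) : ℝ) : EReal) with hS
  have hle : ∀ m : ℕ, 1 ≤ m → (((u m - D) / (m + k) : ℝ) : EReal) ≤ S := fun m hm =>
    le_iSup₂_of_le m hm le_rfl
  refine tendsto_of_le_liminf_of_limsup_le ?_ ?_
  · refine iSup₂_le fun m hm => ?_
    obtain ⟨B, hB⟩ := exists_lower_bound_of_superadditive_gap h hm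
    have hlim : Tendsto (fun n : ℕ => (((u m - D) / (m + k) - B / n : ℝ) : EReal)) atTop
        (𝓝 (((u m - D) / (m + k) : ℝ) : EReal)) := by
      refine (continuous_coe_real_ereal.tendsto _).comp ?_
      simpa using tendsto_const_nhds.sub (tendsto_const_div_atTop_nhds_zero_nat B)
    rw [← hlim.liminf_eq]
    refine liminf_le_liminf ?_
    filter_upwards [eventually_ge_atTop 1] with n hn
    exact EReal.coe_le_coe_iff.2 (hB n hn)
  · rcases eq_or_ne S ⊤ with hT | hT
    · rw [hT]; exact le_top
    have hb : S ≠ ⊥ := fun hb => by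
      have := hle 1 le_rfl
      rw [hb, le_bot_iff] at this
      exact EReal.coe_ne_bot _ this
    lift S to ℝ using ⟨hT, hb⟩ with s
    -- The `n`-th term of the supremum being `≤ s` means `u n ≤ s (n + k) + D`.
    have hlim : Tendsto (fun n : ℕ => ((s + (s * k + D) / n : ℝ) : EReal)) atTop
        (𝓝 (s : EReal)) := by
      refine (continuous_coe_real_ereal.tendsto _).comp ?_
      simpa using tendsto_const_nhds.add (tendsto_const_div_atTop_nhds_zero_nat (s * k + D))
    rw [← hlim.limsup_eq]
    refine limsup_le_limsup ?_
    filter_upwards [eventually_ge_atTop 1] with n hn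
    have hn0 : (0 : ℝ) < n := by exact_mod_cast hn
    refine EReal.coe_le_coe_iff.2 ?_
    have := EReal.coe_le_coe_iff.1 (hle n hn)
    rw [div_le_iff₀ (by positivity)] at this
    rw [div_le_iff₀ hn0, add_mul, div_mul_cancel₀ _ hn0.ne']
    linarith

/-! ### Entropy of finite partitions -/

section Entropy

variable {X A B : Type*} [MeasurableSpace X] [Fintype A] [Fintype B]

/-- The pointwise form of Gibbs' inequality. -/
theorem negMulLog_le_of_zero_imp {p q : ℝ} (hp : 0 ≤ p) (hq : 0 ≤ q) (h : q = 0 → p = 0) :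
    Real.negMulLog p ≤ -(p * Real.log q) + q - p := by
  rcases hp.eq_or_lt with rfl | hp
  · simpa using hq
  have hq' : 0 < q := lt_of_le_of_ne hq fun e => hp.ne' (h e.symm)
  have h1 := Real.log_le_sub_one_of_pos (div_pos hq' hp)
  rw [Real.log_div hq'.ne' hp.ne'] at h1
  have h2 := mul_le_mul_of_nonneg_left h1 hp.le
  have h3 : p * (q / p - 1) = q - p := by field_simp
  rw [Real.negMulLog]
  linarith

variable [MeasurableSpace A] [MeasurableSingletonClass A]
  [MeasurableSpace B] [MeasurableSingletonClass B]

/-- Turns sums over cells into integrals, where invariance of the measure can be applied. -/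
theorem sum_measureReal_preimage_mul {μ : Measure X} [IsProbabilityMeasure μ] {f : X → A}
    (hf : Measurable f) (F : A → ℝ) :
    ∑ a, μ.real (f ⁻¹' {a}) * F a = ∫ x, F (f x) ∂μ := by
  have : IsProbabilityMeasure (μ.map f) := Measure.isProbabilityMeasure_map hf.aemeasurable
  rw [← integral_map (φ := f) hf.aemeasurable
    (Measurable.aestronglyMeasurable (measurable_of_finite F)), integral_fintype .of_finite]
  refine Finset.sum_congr rfl fun a _ => ?_
  rw [map_measureReal_apply hf (measurableSet_singleton a), smul_eq_mul]

theorem sum_measureReal_preimage {μ : Measure X} [IsProbabilityMeasure μ] {f : X → A}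
    (hf : Measurable f) : ∑ a, μ.real (f ⁻¹' {a}) = 1 := by
  simpa using sum_measureReal_preimage_mul (μ := μ) hf (fun _ => 1)

theorem integrable_comp_of_finite {μ : Measure X} [IsFiniteMeasure μ] {f : X → A}
    (hf : Measurable f) (F : A → ℝ) : Integrable (fun x => F (f x)) μ := by
  have := hf.aemeasurable (μ := μ)
  exact Integrable.comp_measurable (g := F) .of_finite hf

/-- Gibbs' inequality. -/
theorem shannonEntropy_le_of_sum_le_one {μ : Measure X} [IsProbabilityMeasure μ] {f : X → A}
    (hf : Measurable f) {w : A → ℝ} (hw : ∀ a, 0 ≤ w a) (hsum : ∑ a, w a ≤ 1)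
    (h0 : ∀ a, w a = 0 → μ.real (f ⁻¹' {a}) = 0) :
    shannonEntropy μ f ≤ -∑ a, μ.real (f ⁻¹' {a}) * Real.log (w a) := by
  have h1 : shannonEntropy μ f ≤
      ∑ a, (-(μ.real (f ⁻¹' {a}) * Real.log (w a)) + w a - μ.real (f ⁻¹' {a})) :=
    Finset.sum_le_sum fun a _ =>
      negMulLog_le_of_zero_imp measureReal_nonneg (hw a) (h0 a)
  rw [Finset.sum_sub_distrib, Finset.sum_add_distrib, Finset.sum_neg_distrib,
    sum_measureReal_preimage hf] at h1
  linarith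

theorem shannonEntropy_nonneg {X A : Type*} [MeasurableSpace X] [Fintype A] {μ : Measure X}
    [IsProbabilityMeasure μ] {f : X → A} : 0 ≤ shannonEntropy μ f :=
  Finset.sum_nonneg fun _ _ => Real.negMulLog_nonneg measureReal_nonneg measureReal_le_one

theorem shannonEntropy_eq_integral {μ : Measure X} [IsProbabilityMeasure μ] {f : X → A}
    (hf : Measurable f) :
    shannonEntropy μ f = -∫ x, Real.log (μ.real (f ⁻¹' {f x})) ∂μ := by
  rw [← sum_measureReal_preimage_mul hf (fun a => Real.log (μ.real (f ⁻¹' {a}))),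
    ← Finset.sum_neg_distrib]
  refine Finset.sum_congr rfl fun a _ => ?_
  rw [Real.negMulLog, neg_mul]

/-- A coarser partition has smaller entropy. -/
theorem shannonEntropy_le_of_factors {μ : Measure X} [IsProbabilityMeasure μ] {f : X → A}
    {g : X → B} (hf : Measurable f) (hg : Measurable g) (h : ∀ x y, f x = f y → g x = g y) :
    shannonEntropy μ g ≤ shannonEntropy μ f := by
  obtain ⟨x₀⟩ : Nonempty X := nonempty_of_isProbabilityMeasure μ
  have : Nonempty B := ⟨g x₀⟩
  have h' : Function.FactorsThrough g f := fun x y => h x y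
  obtain ⟨e, rfl⟩ := (Function.factorsThrough_iff g).1 h'
  rw [shannonEntropy_eq_integral hg, neg_le]
  have : shannonEntropy μ f = -∑ a, μ.real (f ⁻¹' {a}) * Real.log (μ.real (f ⁻¹' {a})) := by
    rw [← Finset.sum_neg_distrib]
    exact Finset.sum_congr rfl fun a _ => by rw [Real.negMulLog, neg_mul]
  rw [this, neg_neg]
  refine le_trans ?_ (sum_measureReal_preimage_mul hf
    (fun a => Real.log (μ.real ((e ∘ f) ⁻¹' {e a})))).le
  refine Finset.sum_le_sum fun a _ => ?_
  rcases (measureReal_nonneg (μ := μ) (s := f ⁻¹' {a})).eq_or_lt with h0 | h0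
  · rw [← h0]; simp
  refine mul_le_mul_of_nonneg_left (Real.log_le_log h0 (measureReal_mono ?_)) h0.le
  rintro x rfl
  simp

end Entropy

/-! ### Concavity, conditional entropy of itineraries, i.i.d. sequences -/

section Entropy

variable {X A B : Type*} [MeasurableSpace X] [Fintype A] [Fintype B]

/-- Entropy is concave as a function of the measure. -/
theorem sum_shannonEntropy_le_of_average {μ : Measure X} {N : ℕ} (hN : 1 ≤ N)
    {m : ℕ → Measure X} {f : X → A}
    (h : ∀ a, μ.real (f ⁻¹' {a}) = (∑ j ∈ Finset.range N, (m j).real (f ⁻¹' {a})) / N) :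
    ∑ j ∈ Finset.range N, shannonEntropy (m j) f ≤ N * shannonEntropy μ f := by
  have hN0 : (0 : ℝ) < N := by exact_mod_cast hN
  simp only [shannonEntropy]
  rw [Finset.sum_comm, Finset.mul_sum]
  refine Finset.sum_le_sum fun a _ => ?_
  have h1 := Real.concaveOn_negMulLog.le_map_sum (t := Finset.range N) (w := fun _ => (N : ℝ)⁻¹)
    (p := fun j => (m j).real (f ⁻¹' {a})) (fun _ _ => by positivity)
    (by simp [hN0.ne']) (fun j _ => measureReal_nonneg)
  simp only [smul_eq_mul] at h1
  rw [← Finset.mul_sum, ← Finset.mul_sum] at h1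
  rw [h a, div_eq_inv_mul]
  have h2 := mul_le_mul_of_nonneg_left h1 hN0.le
  rwa [← mul_assoc, mul_inv_cancel₀ hN0.ne', one_mul] at h2

theorem integral_comp_of_measurePreserving {Y : Type*} [MeasurableSpace Y] {μ : Measure X}
    {ν : Measure Y} {S : X → Y} (hS : MeasurePreserving S μ ν) {F : Y → ℝ}
    (hF : AEStronglyMeasurable F ν) : ∫ x, F (S x) ∂μ = ∫ y, F y ∂ν := by
  rw [← hS.map_eq] at hF ⊢
  rw [integral_map hS.measurable.aemeasurable hF]

theorem sum_measureReal_prodMk_preimage [MeasurableSpace A]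
    [MeasurableSingletonClass A] {B : Type*} {μ : Measure X} [IsProbabilityMeasure μ]
    {f : X → A} {g : X → B} (hf : Measurable f) (b : B) :
    ∑ a, μ.real ((fun x => (f x, g x)) ⁻¹' {(a, b)}) = μ.real (g ⁻¹' {b}) := by
  have h1 : ∀ a, μ.real ((fun x => (f x, g x)) ⁻¹' {(a, b)}) =
      (μ.restrict (g ⁻¹' {b})).real (f ⁻¹' {a}) := fun a => by
    rw [measureReal_restrict_apply (hf (measurableSet_singleton a))]
    congr 1
    ext x
    simp [Prod.ext_iff]
  simp only [h1]
  rw [sum_measureReal_preimage_singleton _ fun a _ => hf (measurableSet_singleton a)]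
  simp

variable [MeasurableSpace A] [MeasurableSingletonClass A]
  [MeasurableSpace B] [MeasurableSingletonClass B]

/-- The itinerary entropy of `f` is bounded by that of `g`, up to the conditional entropy of `f`
given `g` for each time step. -/
theorem shannonEntropy_itinerary_le {μ : Measure X} [IsProbabilityMeasure μ] {S : X → X}
    (hS : MeasurePreserving S μ μ) {f : X → A} {g : X → B} (hf : Measurable f)
    (hg : Measurable g) (n : ℕ) :
    shannonEntropy μ (fun x (j : Fin n) => f (S^[j] x)) ≤
      shannonEntropy μ (fun x (j : Fin n) => g (S^[j] x)) +
        n * (shannonEntropy μ (fun x => (f x, g x)) - shannonEntropy μ g) := by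
  set F : X → Fin n → A := fun x j => f (S^[j] x) with hFdef
  set G : X → Fin n → B := fun x j => g (S^[j] x) with hGdef
  have hSj : ∀ j : ℕ, Measurable S^[j] := fun j => hS.measurable.iterate j
  have hF : Measurable F := measurable_pi_lambda _ fun j => hf.comp (hSj j)
  have hG : Measurable G := measurable_pi_lambda _ fun j => hg.comp (hSj j)
  have hfg : Measurable fun x => (f x, g x) := hf.prodMk hg
  have hFG : Measurable fun x => (F x, G x) := hF.prodMk hG
  set J : A × B → ℝ := fun p => μ.real ((fun x => (f x, g x)) ⁻¹' {p}) with hJ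
  set M : B → ℝ := fun b => μ.real (g ⁻¹' {b}) with hM
  set K : (Fin n → B) → ℝ := fun b => μ.real (G ⁻¹' {b}) with hK
  -- Comparison law for Gibbs' inequality: draw the `g`-itinerary from `μ`, then each `f`-letter
  -- independently, conditioned on the `g`-letter at the same time. This replaces the chain rule and
  -- subadditivity of conditional entropy.
  let w : (Fin n → A) × (Fin n → B) → ℝ := fun p => K p.2 * ∏ j, (J (p.1 j, p.2 j) / M (p.2 j))
  have hpos : ∀ p, μ.real ((fun x => (F x, G x)) ⁻¹' {p}) ≠ 0 →
      0 < K p.2 ∧ ∀ j, 0 < J (p.1 j, p.2 j) ∧ 0 < M (p.2 j) := by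
    rintro ⟨a, b⟩ hp
    have hp' : 0 < μ.real ((fun x => (F x, G x)) ⁻¹' {(a, b)}) :=
      lt_of_le_of_ne measureReal_nonneg hp.symm
    refine ⟨hp'.trans_le (measureReal_mono ?_), fun j => ?_⟩
    · intro x hx
      have hx' : (F x, G x) = (a, b) := hx
      exact (Prod.ext_iff.1 hx').2
    have h1 : 0 < J (a j, b j) := by
      have e : J (a j, b j) =
          μ.real (S^[j] ⁻¹' ((fun x => (f x, g x)) ⁻¹' {(a j, b j)})) := by
        rw [measureReal_def, (hS.iterate j).measure_preimage
          (hfg (measurableSet_singleton _)).nullMeasurableSet]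
        rfl
      rw [e]
      refine hp'.trans_le (measureReal_mono ?_)
      intro x hx
      have hx' : (F x, G x) = (a, b) := hx
      obtain ⟨h2, h3⟩ := Prod.ext_iff.1 hx'
      exact Prod.ext (congrFun h2 j) (congrFun h3 j)
    refine ⟨h1, h1.trans_le (measureReal_mono ?_)⟩
    intro x hx
    have hx' : (f x, g x) = (a j, b j) := hx
    exact (Prod.ext_iff.1 hx').2
  have hJ0 : ∀ p, 0 ≤ J p := fun p => measureReal_nonneg
  have hM0 : ∀ p, 0 ≤ M p := fun p => measureReal_nonneg
  have hK0 : ∀ p, 0 ≤ K p := fun p => measureReal_nonneg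
  have hw0 : ∀ p, 0 ≤ w p := fun p =>
    mul_nonneg (hK0 _) (Finset.prod_nonneg fun j _ => div_nonneg (hJ0 _) (hM0 _))
  have hsum : ∑ p, w p ≤ 1 := by
    rw [Fintype.sum_prod_type_right]
    refine le_trans (Finset.sum_le_sum fun b _ => ?_) (sum_measureReal_preimage (μ := μ) hG).le
    change ∑ a : Fin n → A, K b * ∏ j, (J (a j, b j) / M (b j)) ≤ K b
    rw [← Finset.mul_sum]
    refine mul_le_of_le_one_right (hK0 _) ?_
    have e := Finset.prod_univ_sum (fun _ : Fin n => (Finset.univ : Finset A))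
      (fun j a => J (a, b j) / M (b j))
    rw [Fintype.piFinset_univ] at e
    rw [← e]
    refine Finset.prod_le_one (fun j _ => Finset.sum_nonneg fun a _ =>
      div_nonneg (hJ0 _) (hM0 _)) fun j _ => ?_
    -- The quotient is `0`, not `1`, when `M (b j) = 0`; hence only a sub-probability.
    rw [← Finset.sum_div, sum_measureReal_prodMk_preimage hf]
    exact div_self_le_one _
  have h0 : ∀ p, w p = 0 → μ.real ((fun x => (F x, G x)) ⁻¹' {p}) = 0 := by
    intro p hp
    by_contra hne
    obtain ⟨h1, h2⟩ := hpos p hne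
    have : 0 < w p := mul_pos h1 (Finset.prod_pos fun j _ => div_pos (h2 j).1 (h2 j).2)
    exact this.ne' hp
  have key := shannonEntropy_le_of_sum_le_one hFG hw0 hsum h0
  have hle : shannonEntropy μ F ≤ shannonEntropy μ (fun x => (F x, G x)) :=
    shannonEntropy_le_of_factors hFG hF fun x y hxy => (Prod.ext_iff.1 hxy).1
  have hlog : ∑ p, μ.real ((fun x => (F x, G x)) ⁻¹' {p}) * Real.log (w p) =
      ∑ p, μ.real ((fun x => (F x, G x)) ⁻¹' {p}) *
        (Real.log (K p.2) + ∑ j, (Real.log (J (p.1 j, p.2 j)) - Real.log (M (p.2 j)))) := by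
    refine Finset.sum_congr rfl fun p _ => ?_
    by_cases hne : μ.real ((fun x => (F x, G x)) ⁻¹' {p}) = 0
    · rw [hne, zero_mul, zero_mul]
    obtain ⟨h1, h2⟩ := hpos p hne
    congr 1
    rw [Real.log_mul h1.ne' (Finset.prod_pos fun j _ => div_pos (h2 j).1 (h2 j).2).ne',
      Real.log_prod fun j _ => (div_pos (h2 j).1 (h2 j).2).ne']
    congr 1
    exact Finset.sum_congr rfl fun j _ => Real.log_div (h2 j).1.ne' (h2 j).2.ne'
  have hint : ∀ j : Fin n, Integrable (fun x => Real.log (J (F x j, G x j)) -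
      Real.log (M (G x j))) μ := fun j =>
    integrable_comp_of_finite hFG (fun p => Real.log (J (p.1 j, p.2 j)) - Real.log (M (p.2 j)))
  have hstep : ∀ j : Fin n, ∫ x, (Real.log (J (F x j, G x j)) - Real.log (M (G x j))) ∂μ =
      shannonEntropy μ g - shannonEntropy μ (fun x => (f x, g x)) := fun j => by
    have i1 : Integrable (fun x => Real.log (J (f x, g x))) μ :=
      integrable_comp_of_finite hfg (fun p => Real.log (J p))
    have i2 : Integrable (fun x => Real.log (M (g x))) μ :=
      integrable_comp_of_finite hg (fun p => Real.log (M p))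
    refine (integral_comp_of_measurePreserving (hS.iterate j)
      (F := fun x => Real.log (J (f x, g x)) - Real.log (M (g x)))
      (i1.sub i2).aestronglyMeasurable).trans ?_
    rw [integral_sub i1 i2, shannonEntropy_eq_integral hg, shannonEntropy_eq_integral hfg]
    ring
  rw [hlog, sum_measureReal_preimage_mul hFG (fun p =>
      (Real.log (K p.2) + ∑ j, (Real.log (J (p.1 j, p.2 j)) - Real.log (M (p.2 j))))),
    integral_add (integrable_comp_of_finite hG (fun b => Real.log (K b)))
      (integrable_finsetSum _ fun j _ => hint j), integral_finsetSum _ fun j _ => hint j] at key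
  simp only [hstep, Finset.sum_const, Finset.card_univ, Fintype.card_fin, nsmul_eq_mul] at key
  rw [shannonEntropy_eq_integral hG]
  linarith

/-- The entropy of `t` consecutive coordinates of an i.i.d. sequence. -/
theorem shannonEntropy_infinitePi (P : Measure A) [IsProbabilityMeasure P] (i t : ℕ) :
    shannonEntropy (Measure.infinitePi fun _ : ℕ => P) (fun ω (j : Fin t) => ω (i + j)) =
      t * shannonEntropy P (fun a => a) := by
  set Q := Measure.infinitePi fun _ : ℕ => P with hQ
  have hm : Measurable fun (ω : ℕ → A) (j : Fin t) => ω (i + j) := by fun_prop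
  have hinj : Function.Injective fun j : Fin t => i + (j : ℕ) := fun a b h => by
    ext; simpa using h
  have hmass : ∀ w : Fin t → A,
      Q.real ((fun (ω : ℕ → A) (j : Fin t) => ω (i + j)) ⁻¹' {w}) = ∏ j, P.real {w j} := by
    intro w
    have := Measure.map_infinitePi_infinitePi_of_inj (P := fun _ : ℕ => P) hinj
    rw [← map_measureReal_apply hm (measurableSet_singleton w), hQ, this, measureReal_def,
      Measure.infinitePi_singleton_of_fintype, ENNReal.toReal_prod]
    rfl
  have hlog : shannonEntropy Q (fun ω (j : Fin t) => ω (i + j)) =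
      -∑ w : Fin t → A, Q.real ((fun (ω : ℕ → A) (j : Fin t) => ω (i + j)) ⁻¹' {w}) *
        ∑ j, Real.log (P.real {w j}) := by
    rw [← Finset.sum_neg_distrib]
    refine Finset.sum_congr rfl fun w _ => ?_
    rw [Real.negMulLog, neg_mul, hmass]
    by_cases h : ∏ j, P.real {w j} = 0
    · rw [h, zero_mul, zero_mul]
    rw [Real.log_prod fun j _ hj => h (Finset.prod_eq_zero (Finset.mem_univ j) hj)]
  rw [hlog, sum_measureReal_preimage_mul hm (fun w => ∑ j, Real.log (P.real {w j})),
    integral_finsetSum _ fun j _ => integrable_comp_of_finite hm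
      (fun w => Real.log (P.real {w j}))]
  have h1 : ∀ j : Fin t, ∫ ω, Real.log (P.real {ω (i + j)}) ∂Q =
      -shannonEntropy P (fun a => a) := fun j => by
    rw [shannonEntropy_eq_integral measurable_id', neg_neg]
    exact integral_comp_of_measurePreserving
      (measurePreserving_eval_infinitePi (fun _ : ℕ => P) (i + j))
      (F := fun a => Real.log (P.real {a})) (measurable_of_finite _).aestronglyMeasurable
  simp [h1]

/-- A probability vector on a finite type is the mass function of a probability measure. -/
theorem exists_isProbabilityMeasure_real_singleton {p : A → ℝ} (hp : ∀ a, 0 ≤ p a)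
    (hsum : ∑ a, p a = 1) :
    ∃ P : Measure A, IsProbabilityMeasure P ∧ ∀ a, P.real {a} = p a := by
  classical
  have h1 : ∑ a, ENNReal.ofReal (p a) = 1 := by
    rw [← ENNReal.ofReal_sum_of_nonneg fun a _ => hp a, hsum, ENNReal.ofReal_one]
  refine ⟨(PMF.ofFintype (fun a => ENNReal.ofReal (p a)) h1).toMeasure, inferInstance,
    fun a => ?_⟩
  rw [measureReal_def, PMF.toMeasure_apply_singleton _ _ (measurableSet_singleton a),
    PMF.ofFintype_apply, ENNReal.toReal_ofReal (hp a)]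

end Entropy

/-! ### The shift space -/

section ShiftSpace

variable {q : ℕ} {T : Matrix (Fin q) (Fin q) ℤ}

theorem isClosed_shiftSpace (T : Matrix (Fin q) (Fin q) ℤ) : IsClosed (shiftSpace T) := by
  have : shiftSpace T = ⋂ i : ℕ, {x : ℕ → Fin q | T (x i) (x (i + 1)) = 1} := by
    ext x; simp [shiftSpace]
  rw [this]
  refine isClosed_iInter fun i => ?_
  have hc : Continuous fun x : ℕ → Fin q => (x i, x (i + 1)) := by fun_prop
  exact (isClosed_discrete {p : Fin q × Fin q | T p.1 p.2 = 1}).preimage hc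

instance compactSpace_shiftSpace : CompactSpace (shiftSpace T) :=
  isCompact_iff_compactSpace.1 (isClosed_shiftSpace T).isCompact

theorem measurable_coord (i : ℕ) : Measurable fun x : shiftSpace T => x.1 i :=
  (measurable_pi_apply i).comp measurable_subtype_coe

theorem measurable_shift : Measurable (shift T) :=
  (measurable_pi_lambda _ fun i => measurable_coord (i + 1)).subtype_mk

theorem shift_iterate_coord (n : ℕ) (x : shiftSpace T) (i : ℕ) :
    ((shift T)^[n] x).1 i = x.1 (i + n) := by
  induction n generalizing x with
  | zero => rfl
  | succ n ih =>
    rw [Function.iterate_succ_apply, ih]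
    change x.1 (i + n + 1) = _
    rw [add_assoc]

/-- The word formed by the first `n` letters of a point. -/
def initialWord (n : ℕ) (x : shiftSpace T) : Fin n → Fin q := fun j => x.1 j

theorem measurable_initialWord (n : ℕ) : Measurable (initialWord (T := T) n) :=
  measurable_pi_lambda _ fun j => measurable_coord j

theorem initialWord_eq_iff {n : ℕ} {x y : shiftSpace T} :
    initialWord n x = initialWord n y ↔ ∀ j < n, x.1 j = y.1 j :=
  ⟨fun h j hj => congrFun h ⟨j, hj⟩, fun h => funext fun j => h j j.2⟩

theorem itinerary_zero_coord (n : ℕ) :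
    (fun (x : shiftSpace T) (j : Fin n) => ((shift T)^[j] x).1 0) = initialWord n := by
  ext x j
  rw [shift_iterate_coord, Nat.zero_add]
  rfl

/-- Every preimage under `g` is a union of cylinders of length `m`, of which there are finitely
many. -/
theorem measurable_of_initialWord {α : Type*} [MeasurableSpace α] {g : shiftSpace T → α} {m : ℕ}
    (hg : ∀ x y : shiftSpace T, (∀ j < m, x.1 j = y.1 j) → g x = g y) : Measurable g := by
  intro s _
  have : g ⁻¹' s = initialWord m ⁻¹' (initialWord m '' (g ⁻¹' s)) := by
    refine Set.Subset.antisymm (Set.subset_preimage_image _ _) ?_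
    rintro x ⟨y, hy, hxy⟩
    have := hg y x (initialWord_eq_iff.1 hxy)
    rwa [Set.mem_preimage, ← this]
  rw [this]
  exact measurable_initialWord m (Set.toFinite _).measurableSet

/-- The algebra of the sets which depend on finitely many coordinates. -/
def finiteCoordSets (T : Matrix (Fin q) (Fin q) ℤ) : Set (Set (shiftSpace T)) :=
  {s | ∃ m : ℕ, ∀ x y : shiftSpace T, (∀ j < m, x.1 j = y.1 j) → (x ∈ s ↔ y ∈ s)}

theorem isSetAlgebra_finiteCoordSets : IsSetAlgebra (finiteCoordSets T) where
  empty_mem := ⟨0, fun x y _ => by simp⟩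
  compl_mem := by
    rintro s ⟨m, hm⟩
    exact ⟨m, fun x y h => not_congr (hm x y h)⟩
  union_mem := by
    rintro s t ⟨m, hm⟩ ⟨n, hn⟩
    refine ⟨max m n, fun x y h => or_congr (hm x y fun j hj => h j ?_) (hn x y fun j hj => h j ?_)⟩
    · exact lt_max_of_lt_left hj
    · exact lt_max_of_lt_right hj

theorem generateFrom_finiteCoordSets :
    (inferInstance : MeasurableSpace (shiftSpace T)) =
      MeasurableSpace.generateFrom (finiteCoordSets T) := by
  refine le_antisymm ?_ (MeasurableSpace.generateFrom_le ?_)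
  · refine Measurable.comap_le (m₂ := MeasurableSpace.pi) ?_
    refine @measurable_pi_lambda _ _ _ (MeasurableSpace.generateFrom (finiteCoordSets T)) _ _
      fun i => ?_
    intro s _
    refine MeasurableSpace.measurableSet_generateFrom ⟨i + 1, fun x y h => ?_⟩
    rw [Set.mem_preimage, Set.mem_preimage, h i (Nat.lt_succ_self i)]
  · rintro s ⟨m, hm⟩
    have : Measurable fun x => (x ∈ s) :=
      measurable_of_initialWord (m := m) fun x y h => propext (hm x y h)
    exact measurableSet_setOfPred.2 this

/-- A finite measurable partition is approximated by partitions into cylinders. -/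
theorem exists_approx_initialWord (μ : Measure (shiftSpace T)) [IsProbabilityMeasure μ] {k : ℕ}
    {f : shiftSpace T → Fin k} (hf : Measurable f) {ε : ℝ} (hε : 0 < ε) :
    ∃ (m : ℕ) (g : shiftSpace T → Fin k),
      (∀ x y : shiftSpace T, (∀ j < m, x.1 j = y.1 j) → g x = g y) ∧
      μ.real {x | g x ≠ f x} < ε := by
  classical
  obtain ⟨x₀⟩ : Nonempty (shiftSpace T) := nonempty_of_isProbabilityMeasure μ
  have hk : 0 < k := (f x₀).pos
  have hk' : (0 : ℝ) < k := by exact_mod_cast hk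
  have hdense := Measure.MeasureDense.of_generateFrom_isSetAlgebra_finite μ
    (isSetAlgebra_finiteCoordSets (T := T)) generateFrom_finiteCoordSets
  have happ : ∀ a : Fin k, ∃ t ∈ finiteCoordSets T,
      μ (symmDiff (f ⁻¹' {a}) t) < ENNReal.ofReal (ε / k) := fun a =>
    hdense.approx _ (hf (measurableSet_singleton a)) (measure_ne_top _ _) _ (by positivity)
  choose t ht hμt using happ
  choose m hm using ht
  -- The approximating sets `t a` may overlap or fail to cover; an arbitrary choice is harmless,
  -- because outside the symmetric differences the only `a` with `x ∈ t a` is `f x`.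
  refine ⟨Finset.univ.sup m, fun x => if h : ∃ a, x ∈ t a then h.choose else f x₀, ?_, ?_⟩
  · intro x y hxy
    have : ∀ a, x ∈ t a ↔ y ∈ t a := fun a =>
      hm a x y fun j hj => hxy j (hj.trans_le (Finset.le_sup (Finset.mem_univ a)))
    simp only [this]
  · have hsub : {x | (if h : ∃ a, x ∈ t a then h.choose else f x₀) ≠ f x} ⊆
        ⋃ a ∈ (Finset.univ : Finset (Fin k)), symmDiff (f ⁻¹' {a}) (t a) := by
      intro x hx
      by_contra hx'
      have hiff : ∀ a, f x = a ↔ x ∈ t a := fun a => by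
        by_contra hne
        refine hx' (Set.mem_iUnion₂.2 ⟨a, Finset.mem_univ a, ?_⟩)
        rw [Set.mem_symmDiff]
        simp only [Set.mem_preimage, Set.mem_singleton_iff]
        tauto
      have hex : ∃ a, x ∈ t a := ⟨f x, (hiff _).1 rfl⟩
      rw [Set.mem_ofPred_eq, dif_pos hex] at hx
      exact hx ((hiff _).2 hex.choose_spec).symm
    calc μ.real _ ≤ μ.real (⋃ a ∈ (Finset.univ : Finset (Fin k)), symmDiff (f ⁻¹' {a}) (t a)) :=
          measureReal_mono hsub (measure_ne_top _ _)
      _ ≤ ∑ a, μ.real (symmDiff (f ⁻¹' {a}) (t a)) := measureReal_biUnion_finset_le _ _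
      _ < ∑ _a : Fin k, ε / k := by
          have : Nonempty (Fin k) := ⟨f x₀⟩
          refine Finset.sum_lt_sum_of_nonempty Finset.univ_nonempty fun a _ => ?_
          rw [measureReal_def]
          exact (ENNReal.lt_ofReal_iff_toReal_lt (measure_ne_top _ _)).1 (hμt a)
      _ = ε := by
          simp only [Finset.sum_const, Finset.card_univ, Fintype.card_fin, nsmul_eq_mul]
          field_simp

end ShiftSpace

/-! ### Reduction of arbitrary partitions to cylinders -/

/-- Entropy is continuous in the partition. -/
theorem tendsto_shannonEntropy {X A : Type*} [MeasurableSpace X] [Fintype A] [MeasurableSpace A]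
    [MeasurableSingletonClass A] {μ : Measure X} [IsProbabilityMeasure μ] {F : ℕ → X → A}
    {f : X → A} (hF : ∀ i, Measurable (F i)) (hf : Measurable f)
    (h : Tendsto (fun i => μ.real {x | F i x ≠ f x}) atTop (𝓝 0)) :
    Tendsto (fun i => shannonEntropy μ (F i)) atTop (𝓝 (shannonEntropy μ f)) := by
  refine tendsto_finsetSum _ fun a _ => (Real.continuous_negMulLog.tendsto _).comp ?_
  rw [tendsto_iff_dist_tendsto_zero]
  refine squeeze_zero (fun _ => dist_nonneg) (fun i => ?_) h
  rw [Real.dist_eq]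
  refine (abs_measureReal_sub_le_measureReal_symmDiff (hF i (measurableSet_singleton a)).nullMeasurableSet
    (hf (measurableSet_singleton a)).nullMeasurableSet).trans (measureReal_mono ?_)
  intro x hx
  rw [Set.mem_symmDiff] at hx
  simp only [Set.mem_preimage, Set.mem_singleton_iff] at hx
  change F i x ≠ f x
  rintro he
  rw [he] at hx
  tauto

/-- The Kolmogorov–Sinai theorem for the partition into cylinders: the itinerary entropy of any
finite measurable partition is dominated by the entropy of cylinders. -/
theorem exists_shannonEntropy_itinerary_le {q : ℕ} {T : Matrix (Fin q) (Fin q) ℤ}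
    {μ : Measure (shiftSpace T)} [IsProbabilityMeasure μ]
    (hμ : MeasurePreserving (shift T) μ μ) {k : ℕ} {f : shiftSpace T → Fin k}
    (hf : Measurable f) {δ : ℝ} (hδ : 0 < δ) :
    ∃ m : ℕ, ∀ n : ℕ, shannonEntropy μ (fun x (j : Fin n) => f ((shift T)^[j] x)) ≤
      shannonEntropy μ (initialWord (n + m)) + n * δ := by
  have happ := fun i : ℕ => exists_approx_initialWord μ hf
    (show (0 : ℝ) < 1 / ((i : ℝ) + 1) by positivity)
  choose m g hg hgμ using happ
  have hgm : ∀ i, Measurable (g i) := fun i => measurable_of_initialWord (hg i)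
  have h0 : Tendsto (fun i => μ.real {x | g i x ≠ f x}) atTop (𝓝 0) :=
    squeeze_zero (fun _ => measureReal_nonneg) (fun i => (hgμ i).le)
      tendsto_one_div_add_atTop_nhds_zero_nat
  have h1 := tendsto_shannonEntropy hgm hf h0
  have h2 : Tendsto (fun i => shannonEntropy μ fun x => (f x, g i x)) atTop
      (𝓝 (shannonEntropy μ fun x => (f x, f x))) := by
    refine tendsto_shannonEntropy (fun i => hf.prodMk (hgm i)) (hf.prodMk hf) ?_
    refine h0.congr fun i => ?_
    congr 1
    ext x
    simp
  have h3 : shannonEntropy μ (fun x => (f x, f x)) = shannonEntropy μ f :=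
    le_antisymm
      (shannonEntropy_le_of_factors hf (hf.prodMk hf) fun x y h => by rw [h])
      (shannonEntropy_le_of_factors (hf.prodMk hf) hf fun x y h => (Prod.ext_iff.1 h).1)
  rw [h3] at h2
  -- The conditional entropy of `f` given `g i` tends to that of `f` given `f`, which is zero.
  have h4 := h2.sub h1
  rw [sub_self] at h4
  obtain ⟨i, hi⟩ := (h4.eventually_lt_const hδ).exists
  refine ⟨m i, fun n => ?_⟩
  refine (shannonEntropy_itinerary_le hμ hf (hgm i) n).trans (add_le_add ?_ ?_)
  -- As `g i` reads `m i` letters, its first `n` values along the orbit are determined by `n + m i`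
  -- letters.
  · refine shannonEntropy_le_of_factors (measurable_initialWord _)
      (measurable_pi_lambda _ fun j => (hgm i).comp (measurable_shift.iterate j)) ?_
    intro x y hxy
    rw [initialWord_eq_iff] at hxy
    funext j
    refine hg i _ _ fun l hl => ?_
    rw [shift_iterate_coord, shift_iterate_coord]
    exact hxy _ (by omega)
  · exact mul_le_mul_of_nonneg_left hi.le (by positivity)

variable {q : ℕ} {T : Matrix (Fin q) (Fin q) ℤ}

/-! ### Superadditive sequences of potentials -/

section Superadditive

variable {φ : ℕ → shiftSpace T → ℝ}

theorem IsSuperadditive.continuous_of_zero (hφ : IsSuperadditive T φ) (h0 : φ 0 = 0) (n : ℕ) :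
    Continuous (φ n) := by
  rcases Nat.eq_zero_or_pos n with rfl | hn
  · rw [h0]; exact continuous_zero
  · exact hφ.continuous n hn

/-- The normalisation `φ 0 = 0` admits empty blocks, so that `k = 0` or an empty remainder needs no
case distinction later. -/
theorem IsSuperadditive.superadd_of_zero (hφ : IsSuperadditive T φ) (h0 : φ 0 = 0) (n m : ℕ)
    (x : shiftSpace T) : φ n x + φ m ((shift T)^[n] x) ≤ φ (n + m) x := by
  rcases Nat.eq_zero_or_pos n with rfl | hn
  · simp [h0]
  rcases Nat.eq_zero_or_pos m with rfl | hm
  · simp [h0]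
  exact hφ.superadd n m hn hm x

/-- A superadditive sequence decreases at most linearly. -/
theorem IsSuperadditive.exists_lower_bound (hφ : IsSuperadditive T φ) (h0 : φ 0 = 0) :
    ∃ C : ℝ, 0 ≤ C ∧ ∀ n x, -(C * n) ≤ φ n x := by
  obtain ⟨C, hC⟩ := (isCompact_range (hφ.continuous 1 le_rfl)).bddBelow
  have hC' : ∀ x, C ≤ φ 1 x := fun x => hC (Set.mem_range_self x)
  refine ⟨|C|, abs_nonneg C, fun n => ?_⟩
  induction n with
  | zero => intro x; simp [h0]
  | succ n ih =>
    intro x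
    have h1 := hφ.superadd_of_zero h0 n 1 x
    have h2 := ih x
    have h3 := hC' ((shift T)^[n] x)
    have h4 := neg_abs_le C
    push_cast
    linarith

/-- The tail length `L` stays free so that the induction can split a further block off a tail of
length `M + L`. -/
theorem IsSuperadditive.sum_le (hφ : IsSuperadditive T φ) (h0 : φ 0 = 0) (M L t : ℕ)
    (x : shiftSpace T) :
    ∑ i ∈ Finset.range t, φ M ((shift T)^[i * M] x) + φ L ((shift T)^[t * M] x) ≤
      φ (t * M + L) x := by
  induction t generalizing L with
  | zero => simp
  | succ t ih =>
    have h1 := ih (M + L)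
    have h2 := hφ.superadd_of_zero h0 M L ((shift T)^[t * M] x)
    rw [← Function.iterate_add_apply, show M + t * M = (t + 1) * M by ring] at h2
    rw [Finset.sum_range_succ, show (t + 1) * M + L = t * M + (M + L) by ring]
    linarith

theorem IsSuperadditive.integrable (hφ : IsSuperadditive T φ) (h0 : φ 0 = 0)
    (μ : Measure (shiftSpace T)) [IsFiniteMeasure μ] (n : ℕ) : Integrable (φ n) μ :=
  (hφ.continuous_of_zero h0 n).integrable_of_hasCompactSupport (HasCompactSupport.of_compactSpace _)

theorem IsSuperadditive.integral_iterate (hφ : IsSuperadditive T φ) (h0 : φ 0 = 0)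
    {μ : Measure (shiftSpace T)} [IsFiniteMeasure μ] (hμ : MeasurePreserving (shift T) μ μ)
    (n i : ℕ) : ∫ x, φ n ((shift T)^[i] x) ∂μ = ∫ x, φ n x ∂μ :=
  integral_comp_of_measurePreserving (hμ.iterate i) (hφ.integrable h0 μ n).aestronglyMeasurable

theorem IsSuperadditive.integrable_iterate (hφ : IsSuperadditive T φ) (h0 : φ 0 = 0)
    (μ : Measure (shiftSpace T)) [IsFiniteMeasure μ] (n i : ℕ) :
    Integrable (fun x => φ n ((shift T)^[i] x)) μ :=
  (hφ.integrable h0 (μ.map (shift T)^[i]) n).comp_measurable (measurable_shift.iterate i)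

/-- The averages `(1/n) ∫ φ_n dμ` converge to their supremum. -/
theorem IsSuperadditive.tendsto_averageSeq (hφ : IsSuperadditive T φ) (h0 : φ 0 = 0)
    {μ : Measure (shiftSpace T)} (hμ : μ ∈ invariantMeasures T) :
    Tendsto (averageSeq T φ μ) atTop
      (𝓝 (⨆ (m : ℕ) (_ : 1 ≤ m), (((∫ x, φ m x ∂μ) / m : ℝ) : EReal))) := by
  obtain ⟨hp, hinv⟩ := hμ
  have := tendsto_div_of_superadditive_gap (u := fun n => ∫ x, φ n x ∂μ) (k := 0) (D := 0) (by
    intro n m _ _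
    rw [sub_zero, add_zero, ← hφ.integral_iterate h0 hinv m n,
      ← integral_add (hφ.integrable h0 μ n) (hφ.integrable_iterate h0 μ m n)]
    exact integral_mono ((hφ.integrable h0 μ n).add (hφ.integrable_iterate h0 μ m n))
      (hφ.integrable h0 μ _) (hφ.superadd_of_zero h0 n m))
  simp only [Nat.cast_zero, add_zero, sub_zero] at this
  exact this

/-- Uniform continuity of a potential, in terms of cylinders. -/
theorem exists_le_add_of_agree {f : shiftSpace T → ℝ} (hf : Continuous f) {ε : ℝ} (hε : 0 < ε) :
    ∃ L : ℕ, ∀ x y : shiftSpace T, (∀ j < L, x.1 j = y.1 j) → f x ≤ f y + ε := by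
  have hU : IsOpen {p : shiftSpace T × shiftSpace T | f p.1 < f p.2 + ε} :=
    isOpen_lt (by fun_prop) (by fun_prop)
  -- The closed relations "the first `L` letters agree" decrease to the diagonal, so by compactness
  -- one of them lies in the open set.
  obtain ⟨L, hL⟩ := exists_subset_nhds_of_compactSpace
    (V := fun L : ℕ => {p : shiftSpace T × shiftSpace T | ∀ j < L, p.1.1 j = p.2.1 j})
    (directed_of_isDirected_le fun a b hab p hp j hj => hp j (hj.trans_le hab))
    (fun L => by
      have : {p : shiftSpace T × shiftSpace T | ∀ j < L, p.1.1 j = p.2.1 j} =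
          ⋂ j < L, {p | p.1.1 j = p.2.1 j} := by ext; simp
      rw [this]
      refine isClosed_biInter fun j _ => isClosed_eq ?_ ?_
      · exact (continuous_apply j).comp (continuous_subtype_val.comp continuous_fst)
      · exact (continuous_apply j).comp (continuous_subtype_val.comp continuous_snd))
    (U := {p : shiftSpace T × shiftSpace T | f p.1 < f p.2 + ε}) (by
      rintro ⟨x, y⟩ hxy
      have : x = y := by
        refine Subtype.ext (funext fun j => ?_)
        exact Set.mem_iInter.1 hxy (j + 1) j (Nat.lt_succ_self j)
      subst this
      refine hU.mem_nhds ?_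
      change f x < f x + ε
      linarith)
  exact ⟨L, fun x y h => le_of_lt (hL (show (x, y) ∈ _ from h))⟩

end Superadditive

/-! ### Words, cylinders and the specification property -/

section Words

theorem mem_cylinder_initialWord (n : ℕ) (x : shiftSpace T) : x ∈ cylinder T (initialWord n x) :=
  fun _ => rfl

theorem initialWord_mem_words (n : ℕ) (x : shiftSpace T) : initialWord n x ∈ words T n := by
  classical
  exact Finset.mem_filter.2 ⟨Finset.mem_univ _, fun i _ => x.2 i⟩

/-- Any two letters are joined by an admissible path with `k` letters in between. -/
def HasConnections (T : Matrix (Fin q) (Fin q) ℤ) (k : ℕ) : Prop :=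
  ∀ i j, ∃ c : ℕ → Fin q, c 0 = i ∧ c (k + 1) = j ∧ ∀ l ≤ k, T (c l) (c (l + 1)) = 1

theorem exists_path_of_pow_pos (hT01 : ∀ i j, T i j = 0 ∨ T i j = 1) (k : ℕ) {i j : Fin q}
    (h : 0 < (T ^ k) i j) :
    ∃ c : ℕ → Fin q, c 0 = i ∧ c k = j ∧ ∀ l < k, T (c l) (c (l + 1)) = 1 := by
  induction k generalizing i with
  | zero =>
    refine ⟨fun _ => i, rfl, ?_, by simp⟩
    by_contra hne
    rw [pow_zero, Matrix.one_apply_ne hne] at h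
    exact lt_irrefl _ h
  | succ k ih =>
    rw [pow_succ', Matrix.mul_apply] at h
    obtain ⟨l, -, hl⟩ := Finset.exists_lt_of_sum_lt (s := Finset.univ) (f := fun _ => (0 : ℤ))
      (g := fun l => T i l * (T ^ k) l j) (by simpa using h)
    rcases hT01 i l with h1 | h1
    · simp [h1] at hl
    simp only [h1, one_mul] at hl
    obtain ⟨c, hc0, hck, hc⟩ := ih hl
    refine ⟨fun n => Nat.casesOn n i c, rfl, hck, fun n hn => ?_⟩
    cases n with
    | zero => simpa [hc0] using h1
    | succ n => exact hc n (by omega)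

theorem exists_hasConnections (hT01 : ∀ i j, T i j = 0 ∨ T i j = 1) (hT : T.IsPrimitive) :
    ∃ k, HasConnections T k := by
  obtain ⟨k, hk, hpos⟩ := hT.exists_pos_pow
  obtain ⟨k, rfl⟩ : ∃ k', k = k' + 1 := ⟨k - 1, by omega⟩
  refine ⟨k, fun i j => ?_⟩
  obtain ⟨c, h0, h1, hc⟩ := exists_path_of_pow_pos hT01 _ (hpos i j)
  exact ⟨c, h0, h1, fun l hl => hc l (by omega)⟩

variable {k : ℕ}

/-- Every admissible word is the initial word of a point. -/
theorem HasConnections.exists_initialWord_eq (hk : HasConnections T k) {n : ℕ} (hn : 1 ≤ n)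
    {w : Fin n → Fin q} (hw : w ∈ words T n) : ∃ x : shiftSpace T, initialWord n x = w := by
  classical
  have hw' : IsAdmissible T w := (Finset.mem_filter.1 hw).2
  have hs : ∀ i, ∃ j, T i j = 1 := fun i => by
    obtain ⟨c, h0, -, hc⟩ := hk i i
    exact ⟨c 1, by simpa [h0] using hc 0 (Nat.zero_le k)⟩
  choose s hs using hs
  -- Past the end of the word, follow chosen successors of its last letter.
  refine ⟨⟨fun l => if h : l < n then w ⟨l, h⟩ else s^[l - (n - 1)] (w ⟨n - 1, by omega⟩), ?_⟩, ?_⟩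
  · intro l
    change T (if h : l < n then _ else _) (if h : l + 1 < n then _ else _) = 1
    by_cases h1 : l + 1 < n
    · rw [dif_pos h1, dif_pos (show l < n by omega)]
      exact hw' l h1
    rw [dif_neg h1]
    by_cases h2 : l < n
    · rw [dif_pos h2]
      obtain rfl : n = l + 1 := by omega
      have h3 : l + 1 - (l + 1 - 1) = 1 := by omega
      rw [h3]
      exact hs _
    · rw [dif_neg h2, show l + 1 - (n - 1) = (l - (n - 1)) + 1 by omega,
        Function.iterate_succ_apply']
      exact hs _
  · funext j
    exact dif_pos j.2

/-- Specification: an initial word can be followed by any point after a gap of length `k`. -/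
theorem HasConnections.exists_glue (hk : HasConnections T k) {n : ℕ} (hn : 1 ≤ n)
    (x y : shiftSpace T) :
    ∃ z : shiftSpace T, initialWord n z = initialWord n x ∧ (shift T)^[n + k] z = y := by
  obtain ⟨c, h0, h1, hc⟩ := hk (x.1 (n - 1)) (y.1 0)
  -- The path starts on the last letter of the word: `c 0` sits at position `n - 1` and `c (k + 1)`
  -- at `n + k`, where `y` begins.
  refine ⟨⟨fun l => if l < n then x.1 l else if l < n + k then c (l - (n - 1))
    else y.1 (l - (n + k)), ?_⟩, ?_, ?_⟩
  · intro l
    change T (if l < n then _ else _) (if l + 1 < n then _ else _) = 1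
    by_cases a1 : l + 1 < n
    · rw [if_pos a1, if_pos (show l < n by omega)]
      exact x.2 l
    rw [if_neg a1]
    by_cases a3 : l < n + k
    · have e1 : (if l < n then x.1 l else if l < n + k then c (l - (n - 1))
          else y.1 (l - (n + k))) = c (l - (n - 1)) := by
        by_cases a2 : l < n
        · rw [if_pos a2]
          obtain rfl : l = n - 1 := by omega
          rw [Nat.sub_self, h0]
        · rw [if_neg a2, if_pos a3]
      have e2 : (if l + 1 < n + k then c (l + 1 - (n - 1)) else y.1 (l + 1 - (n + k))) =
          c (l - (n - 1) + 1) := by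
        by_cases a2 : l + 1 < n + k
        · rw [if_pos a2, show l + 1 - (n - 1) = l - (n - 1) + 1 by omega]
        · rw [if_neg a2, show l + 1 - (n + k) = 0 by omega,
            show l - (n - 1) + 1 = k + 1 by omega, h1]
      rw [e1, e2]
      exact hc _ (by omega)
    · by_cases a4 : l < n
      · obtain rfl : l = n - 1 := by omega
        omega
      rw [if_neg a4, if_neg a3, if_neg (by omega),
        show l + 1 - (n + k) = l - (n + k) + 1 by omega]
      exact y.2 _
  · funext j
    exact if_pos j.2
  · refine Subtype.ext (funext fun i => ?_)
    rw [shift_iterate_coord]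
    change (if i + (n + k) < n then _ else _) = _
    rw [if_neg (by omega), if_neg (by omega), Nat.add_sub_cancel]

end Words

/-! ### The topological pressure -/

section Pressure

variable {φ : ℕ → shiftSpace T → ℝ}

/-- The infimum of `φ_n` on the cylinder of a word of length `n`. -/
noncomputable def cylinderInf (φ : ℕ → shiftSpace T → ℝ) (n : ℕ) (w : Fin n → Fin q) : ℝ :=
  sInf (φ n '' cylinder T w)

/-- The lower bound `hC` ensures that `sInf` is a genuine infimum. -/
theorem cylinderInf_initialWord_le {C : ℝ} (hC : ∀ n x, -(C * n) ≤ φ n x) (n : ℕ)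
    (x : shiftSpace T) : cylinderInf φ n (initialWord n x) ≤ φ n x :=
  csInf_le ⟨-(C * n), by rintro _ ⟨y, -, rfl⟩; exact hC n y⟩
    (Set.mem_image_of_mem _ (mem_cylinder_initialWord n x))

theorem le_cylinderInf_initialWord {n : ℕ} {x : shiftSpace T} {b : ℝ}
    (h : ∀ y, initialWord n y = initialWord n x → b ≤ φ n y) :
    b ≤ cylinderInf φ n (initialWord n x) := by
  refine le_csInf ⟨_, Set.mem_image_of_mem _ (mem_cylinder_initialWord n x)⟩ ?_
  rintro _ ⟨y, hy, rfl⟩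
  exact h y (funext hy)

theorem partitionSum_pos [Nonempty (shiftSpace T)] (n : ℕ) : 0 < partitionSum T φ n := by
  obtain ⟨x⟩ := ‹Nonempty (shiftSpace T)›
  exact Finset.sum_pos (fun _ _ => Real.exp_pos _) ⟨_, initialWord_mem_words n x⟩

theorem nonempty_shiftSpace (hq : 1 ≤ q) {k : ℕ} (hk : HasConnections T k) :
    Nonempty (shiftSpace T) := by
  classical
  obtain ⟨x, -⟩ := hk.exists_initialWord_eq (n := 1) le_rfl (w := fun _ => ⟨0, hq⟩)
    (Finset.mem_filter.2 ⟨Finset.mem_univ _, fun i hi => absurd hi (by omega)⟩)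
  exact ⟨x⟩

/-- The logarithms of the partition sums are superadditive up to a gap. -/
theorem IsSuperadditive.log_partitionSum_add_le (hφ : IsSuperadditive T φ) (h0 : φ 0 = 0)
    [Nonempty (shiftSpace T)] {k : ℕ} (hk : HasConnections T k) {C : ℝ}
    (hC : ∀ n x, -(C * n) ≤ φ n x) {n m : ℕ} (hn : 1 ≤ n) (hm : 1 ≤ m) :
    Real.log (partitionSum T φ n) + Real.log (partitionSum T φ m) - C * k ≤
      Real.log (partitionSum T φ (n + k + m)) := by
  classical
  have hpt : ∀ {n : ℕ}, 1 ≤ n → ∀ w : Fin n → Fin q, ∃ x : shiftSpace T,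
      w ∈ words T n → initialWord n x = w := fun hn w => by
    by_cases hw : w ∈ words T _
    · obtain ⟨x, hx⟩ := hk.exists_initialWord_eq hn hw
      exact ⟨x, fun _ => hx⟩
    · exact ⟨Classical.arbitrary _, fun h => absurd h hw⟩
  choose p hp using hpt hn
  choose r hr using hpt hm
  choose z hz1 hz2 using fun x y : shiftSpace T => hk.exists_glue hn x y
  -- The glued word determines `I` by its first `n` letters and `J` by its last `m`, hence
  -- injectivity on admissible pairs. The gap between them costs at most `C k`.
  let Θ : (Fin n → Fin q) × (Fin m → Fin q) → (Fin (n + k + m) → Fin q) :=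
    fun I => initialWord (n + k + m) (z (p I.1) (r I.2))
  have hsplit : ∀ x y : shiftSpace T, initialWord (n + k + m) x = initialWord (n + k + m) y →
      initialWord n x = initialWord n y ∧
        initialWord m ((shift T)^[n + k] x) = initialWord m ((shift T)^[n + k] y) := by
    intro x y h
    rw [initialWord_eq_iff] at h
    refine ⟨initialWord_eq_iff.2 fun j hj => h j (by omega),
      initialWord_eq_iff.2 fun j hj => ?_⟩
    rw [shift_iterate_coord, shift_iterate_coord]
    exact h _ (by omega)
  have hinj : Set.InjOn Θ (words T n ×ˢ words T m : Finset _) := by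
    rintro ⟨I, J⟩ hIJ ⟨I', J'⟩ hIJ' h
    obtain ⟨hI, hJ⟩ := Finset.mem_product.1 hIJ
    obtain ⟨hI', hJ'⟩ := Finset.mem_product.1 hIJ'
    obtain ⟨e1, e2⟩ := hsplit _ _ h
    rw [hz1, hz1, hp I hI, hp I' hI'] at e1
    rw [hz2, hz2, hr J hJ, hr J' hJ'] at e2
    rw [e1, e2]
  have hle : ∀ I ∈ words T n ×ˢ words T m,
      cylinderInf φ n I.1 + cylinderInf φ m I.2 - C * k ≤ cylinderInf φ (n + k + m) (Θ I) := by
    rintro ⟨I, J⟩ hIJ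
    obtain ⟨hI, hJ⟩ := Finset.mem_product.1 hIJ
    refine le_cylinderInf_initialWord fun y hy => ?_
    obtain ⟨e1, e2⟩ := hsplit _ _ hy
    rw [hz1, hp I hI] at e1
    rw [hz2, hr J hJ] at e2
    have a1 := cylinderInf_initialWord_le hC n y
    have a2 := cylinderInf_initialWord_le hC m ((shift T)^[n + k] y)
    rw [e1] at a1
    rw [e2] at a2
    have a3 := hφ.superadd_of_zero h0 (n + k) m y
    have a4 := hφ.superadd_of_zero h0 n k y
    have a5 := hC k ((shift T)^[n] y)
    change cylinderInf φ n I + cylinderInf φ m J - C * k ≤ _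
    linarith
  have hmain : partitionSum T φ n * partitionSum T φ m * Real.exp (-(C * k)) ≤
      partitionSum T φ (n + k + m) := by
    have e : partitionSum T φ n * partitionSum T φ m * Real.exp (-(C * k)) =
        ∑ I ∈ words T n ×ˢ words T m,
          Real.exp (cylinderInf φ n I.1 + cylinderInf φ m I.2 - C * k) := by
      rw [partitionSum, partitionSum, Finset.sum_mul_sum, ← Finset.sum_product', Finset.sum_mul]
      refine Finset.sum_congr rfl fun I _ => ?_
      rw [← Real.exp_add, ← Real.exp_add, ← sub_eq_add_neg]
      rfl
    rw [e]
    calc _ ≤ ∑ I ∈ words T n ×ˢ words T m, Real.exp (cylinderInf φ (n + k + m) (Θ I)) :=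
          Finset.sum_le_sum fun I hI => Real.exp_le_exp.2 (hle I hI)
      _ = ∑ w ∈ (words T n ×ˢ words T m).image Θ, Real.exp (cylinderInf φ (n + k + m) w) :=
          (Finset.sum_image (f := fun w => Real.exp (cylinderInf φ (n + k + m) w)) hinj).symm
      _ ≤ _ := by
          refine Finset.sum_le_sum_of_subset_of_nonneg ?_ fun _ _ _ => (Real.exp_pos _).le
          intro w hw
          obtain ⟨I, -, rfl⟩ := Finset.mem_image.1 hw
          exact initialWord_mem_words _ _
  have hZn := partitionSum_pos (φ := φ) n
  have hZm := partitionSum_pos (φ := φ) m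
  have := Real.log_le_log (by positivity) hmain
  rwa [Real.log_mul (by positivity) (by positivity), Real.log_mul hZn.ne' hZm.ne',
    Real.log_exp, ← sub_eq_add_neg] at this

theorem IsSuperadditive.tendsto_pressureSeq (hφ : IsSuperadditive T φ) (h0 : φ 0 = 0)
    [Nonempty (shiftSpace T)] {k : ℕ} (hk : HasConnections T k) {C : ℝ}
    (hC : ∀ n x, -(C * n) ≤ φ n x) :
    Tendsto (pressureSeq T φ) atTop (𝓝 (⨆ (m : ℕ) (_ : 1 ≤ m),
      (((Real.log (partitionSum T φ m) - C * k) / (m + k) : ℝ) : EReal))) :=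
  tendsto_div_of_superadditive_gap (u := fun n => Real.log (partitionSum T φ n))
    fun _ _ hn hm => hφ.log_partitionSum_add_le h0 hk hC hn hm

/-! ### Invariant measures have at most the topological pressure -/

/-- Gibbs' inequality against the weights `exp (inf φ_m) / Z_m` on words. -/
theorem shannonEntropy_add_integral_cylinderInf_le (φ : ℕ → shiftSpace T → ℝ)
    (μ : Measure (shiftSpace T)) [IsProbabilityMeasure μ] (m : ℕ) :
    shannonEntropy μ (initialWord m) + ∫ x, cylinderInf φ m (initialWord m x) ∂μ ≤
      Real.log (partitionSum T φ m) := by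
  classical
  have : Nonempty (shiftSpace T) := nonempty_of_isProbabilityMeasure μ
  have hZ := partitionSum_pos (φ := φ) m
  have hmeas := measurable_initialWord (T := T) m
  let v : (Fin m → Fin q) → ℝ := fun w =>
    if w ∈ words T m then Real.exp (cylinderInf φ m w) / partitionSum T φ m else 0
  have hzero : ∀ w, w ∉ words T m → μ.real (initialWord m ⁻¹' {w}) = 0 := fun w hw => by
    have : initialWord (T := T) m ⁻¹' {w} = ∅ := by
      refine Set.eq_empty_of_forall_notMem fun x hx => hw ?_
      rw [← show initialWord m x = w from hx]
      exact initialWord_mem_words m x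
    rw [this, measureReal_empty]
  have h1 := shannonEntropy_le_of_sum_le_one (μ := μ) hmeas (w := v)
    (fun w => by
      by_cases hw : w ∈ words T m
      · simp only [v, if_pos hw]; positivity
      · simp only [v, if_neg hw]; exact le_rfl)
    (by
      simp only [v, Finset.sum_ite_mem, Finset.univ_inter, ← Finset.sum_div]
      exact (div_self hZ.ne').le)
    (fun w hw => by
      refine hzero w fun hw' => ?_
      simp only [v, if_pos hw'] at hw
      exact (div_pos (Real.exp_pos _) hZ).ne' hw)
  have h2 : ∑ w, μ.real (initialWord m ⁻¹' {w}) * Real.log (v w) =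
      ∑ w, μ.real (initialWord m ⁻¹' {w}) *
        (cylinderInf φ m w - Real.log (partitionSum T φ m)) := by
    refine Finset.sum_congr rfl fun w _ => ?_
    by_cases hw : w ∈ words T m
    · simp only [v, if_pos hw]
      rw [Real.log_div (Real.exp_pos _).ne' hZ.ne', Real.log_exp]
    · rw [hzero w hw, zero_mul, zero_mul]
  rw [h2, sum_measureReal_preimage_mul hmeas
      (fun w => cylinderInf φ m w - Real.log (partitionSum T φ m)),
    integral_sub (integrable_comp_of_finite hmeas _) (integrable_const _)] at h1
  simp only [integral_const, probReal_univ, one_smul] at h1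
  linarith

/-- Lower bound for the mean infimum over cylinders in terms of a fixed potential `φ_M`. -/
theorem IsSuperadditive.exists_integral_cylinderInf_ge (hφ : IsSuperadditive T φ) (h0 : φ 0 = 0)
    {C : ℝ} (hC : ∀ n x, -(C * n) ≤ φ n x) {μ : Measure (shiftSpace T)} [IsProbabilityMeasure μ]
    (hμ : MeasurePreserving (shift T) μ μ) (M : ℕ) {ε : ℝ} (hε : 0 < ε) :
    ∃ L : ℕ, ∀ t : ℕ, t * (∫ x, φ M x ∂μ) - t * ε - C * L ≤
      ∫ x, cylinderInf φ (t * M + L) (initialWord (t * M + L) x) ∂μ := by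
  -- The words get `L` extra letters so that, at each time `i * M` with `i < t`, two points of one
  -- cylinder still agree on `L` letters.
  obtain ⟨L, hL⟩ := exists_le_add_of_agree (hφ.continuous_of_zero h0 M) hε
  refine ⟨L, fun t => ?_⟩
  have hint : ∀ i ∈ Finset.range t, Integrable (fun x => φ M ((shift T)^[i * M] x)) μ :=
    fun i _ => hφ.integrable_iterate h0 μ M _
  have h1 : ∫ x, (∑ i ∈ Finset.range t, φ M ((shift T)^[i * M] x) - (t * ε + C * L)) ∂μ =
      t * (∫ x, φ M x ∂μ) - t * ε - C * L := by
    rw [integral_sub (integrable_finsetSum _ hint) (integrable_const _),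
      integral_finsetSum _ hint]
    simp only [hφ.integral_iterate h0 hμ, Finset.sum_const, Finset.card_range, nsmul_eq_mul,
      integral_const, probReal_univ, one_smul]
    ring
  rw [← h1]
  refine integral_mono ((integrable_finsetSum _ hint).sub (integrable_const _))
    (integrable_comp_of_finite (measurable_initialWord _) _) fun x => ?_
  refine le_cylinderInf_initialWord fun y hy => ?_
  rw [initialWord_eq_iff] at hy
  have h2 := hφ.sum_le h0 M L t y
  have h3 := hC L ((shift T)^[t * M] y)
  have h4 : ∑ i ∈ Finset.range t, φ M ((shift T)^[i * M] x) ≤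
      ∑ i ∈ Finset.range t, (φ M ((shift T)^[i * M] y) + ε) := by
    refine Finset.sum_le_sum fun i hi => hL _ _ fun j hj => ?_
    rw [shift_iterate_coord, shift_iterate_coord]
    refine (hy _ ?_).symm
    have : i * M ≤ t * M := Nat.mul_le_mul_right M (Finset.mem_range.1 hi).le
    omega
  rw [Finset.sum_add_distrib, Finset.sum_const, Finset.card_range, nsmul_eq_mul] at h4
  linarith

/-- If the pressure is bounded by `p`, then so is the free energy of any invariant measure,
relative to any finite partition and any potential of the sequence. -/
theorem IsSuperadditive.partitionEntropy_le (hφ : IsSuperadditive T φ) (h0 : φ 0 = 0)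
    {C : ℝ} (hC : ∀ n x, -(C * n) ≤ φ n x) {p D : ℝ} {k : ℕ}
    (hp : ∀ m, 1 ≤ m → Real.log (partitionSum T φ m) ≤ p * (m + k) + D)
    {μ : Measure (shiftSpace T)} [IsProbabilityMeasure μ]
    (hμ : MeasurePreserving (shift T) μ μ) {r : ℕ} {f : shiftSpace T → Fin r}
    (hf : Measurable f) {M : ℕ} (hM : 1 ≤ M) :
    partitionEntropy μ (shift T) f ≤ ((p - (∫ x, φ M x ∂μ) / M : ℝ) : EReal) := by
  set I := ∫ x, φ M x ∂μ with hI
  have hM0 : (0 : ℝ) < M := by exact_mod_cast hM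
  suffices hδ : ∀ δ : ℝ, 0 < δ →
      partitionEntropy μ (shift T) f ≤ ((p - I / M + δ / M + δ : ℝ) : EReal) by
    have hlim : Tendsto (fun δ : ℝ => ((p - I / M + δ / M + δ : ℝ) : EReal)) (𝓝[>] 0)
        (𝓝 ((p - I / M : ℝ) : EReal)) := by
      refine (continuous_coe_real_ereal.tendsto _).comp (tendsto_nhdsWithin_of_tendsto_nhds ?_)
      have : Continuous fun δ : ℝ => p - I / M + δ / M + δ := by fun_prop
      simpa using this.tendsto 0
    refine ge_of_tendsto hlim ?_
    filter_upwards [self_mem_nhdsWithin] with δ hδ' using hδ δ hδ'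
  intro δ hδ
  obtain ⟨s, hs⟩ := exists_shannonEntropy_itinerary_le hμ hf hδ
  obtain ⟨L, hL⟩ := hφ.exists_integral_cylinderInf_ge h0 hC hμ M hδ
  -- `Y` is the bound's growth per block of length `M`; `K` collects what does not depend on `n`. As
  -- `Y` may have either sign, rounding `n / M` up to `t` is paid for with `|Y|`.
  set Y := p * M - I + δ with hY
  set K := (s + 1) * |Y| + p * (L + k) + D + C * L with hK
  have hbound : ∀ n : ℕ, shannonEntropy μ (fun x (j : Fin n) => f ((shift T)^[j] x)) ≤
      n * (p - I / M + δ / M + δ) + K := by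
    intro n
    -- Chosen so that `n + s < t * M ≤ n + s + M`.
    set t := (n + s) / M + 1 with ht
    have hdm := Nat.div_add_mod' (n + s) M
    have hmod : (n + s) % M < M := Nat.mod_lt _ (by omega)
    have htM : t * M = (n + s) / M * M + M := by rw [ht]; ring
    have hge : n + s < t * M := by omega
    have hle : t * M ≤ n + s + M := by omega
    have a1 := hs n
    have a2 : shannonEntropy μ (initialWord (n + s)) ≤
        shannonEntropy μ (initialWord (t * M + L)) :=
      shannonEntropy_le_of_factors (measurable_initialWord _) (measurable_initialWord _)
        fun x y h => by
          rw [initialWord_eq_iff] at h ⊢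
          exact fun j hj => h j (by omega)
    have a3 := shannonEntropy_add_integral_cylinderInf_le φ μ (t * M + L)
    have a4 := hL t
    have a5 := hp (t * M + L) (by omega)
    push_cast at a5
    have hge' : (n : ℝ) ≤ t * M := by exact_mod_cast (show n ≤ t * M by omega)
    have hle' : (t : ℝ) * M ≤ n + s + M := by exact_mod_cast hle
    have a6 : t * Y ≤ n / M * Y + (s + 1) * |Y| := by
      have e : (t : ℝ) * Y = n / M * Y + (t - n / M) * Y := by ring
      have b1 : 0 ≤ t - n / (M : ℝ) := by
        rw [sub_nonneg, div_le_iff₀ hM0]; exact hge'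
      have b2 : t - n / (M : ℝ) ≤ s + 1 := by
        rw [sub_le_iff_le_add, ← mul_le_mul_iff_left₀ hM0]
        have : ((s : ℝ) + 1 + n / M) * M = s * M + M + n := by field_simp
        rw [this]
        have hs0 : (s : ℝ) ≤ s * M := by
          have : (1 : ℝ) ≤ M := by exact_mod_cast hM
          exact le_mul_of_one_le_right (by positivity) this
        linarith
      have b3 := mul_le_mul_of_nonneg_left (le_abs_self Y) b1
      have b4 := mul_le_mul_of_nonneg_right b2 (abs_nonneg Y)
      linarith
    have a7 : (n : ℝ) / M * Y = n * (p - I / M + δ / M) := by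
      rw [hY]; field_simp
    have a8 : t * Y = p * (t * M) - t * I + t * δ := by rw [hY]; ring
    rw [hK]
    nlinarith
  have hlim : Tendsto (fun n : ℕ => ((p - I / M + δ / M + δ + K / n : ℝ) : EReal)) atTop
      (𝓝 ((p - I / M + δ / M + δ : ℝ) : EReal)) := by
    refine (continuous_coe_real_ereal.tendsto _).comp ?_
    simpa using tendsto_const_nhds.add (tendsto_const_div_atTop_nhds_zero_nat K)
  rw [← hlim.limsup_eq]
  refine limsup_le_limsup ?_
  filter_upwards [eventually_ge_atTop 1] with n hn
  have hn0 : (0 : ℝ) < n := by exact_mod_cast hn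
  refine EReal.coe_le_coe_iff.2 ?_
  rw [div_le_iff₀ hn0, add_mul, div_mul_cancel₀ _ hn0.ne', mul_comm _ (n : ℝ)]
  exact hbound n

/-- The easy half of the variational principle. -/
theorem IsSuperadditive.entropy_add_asymptoticAverage_le (hφ : IsSuperadditive T φ) (h0 : φ 0 = 0)
    [Nonempty (shiftSpace T)] {k : ℕ} (hk : HasConnections T k)
    {μ : Measure (shiftSpace T)} (hμ : μ ∈ invariantMeasures T) :
    entropy μ (shift T) + asymptoticAverage T φ μ ≤ topPressure T φ := by
  obtain ⟨C, -, hC⟩ := hφ.exists_lower_bound h0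
  have htop : topPressure T φ = _ := (hφ.tendsto_pressureSeq h0 hk hC).limsup_eq
  have havg : asymptoticAverage T φ μ = _ := (hφ.tendsto_averageSeq h0 hμ).limsup_eq
  obtain ⟨hprob, hinv⟩ := hμ
  have hZ : ∀ m : ℕ, 1 ≤ m →
      (((Real.log (partitionSum T φ m) - C * k) / (m + k) : ℝ) : EReal) ≤ topPressure T φ := by
    intro m hm
    rw [htop]
    exact le_iSup₂_of_le m hm le_rfl
  rcases eq_or_ne (topPressure T φ) ⊤ with hT | hT
  · rw [hT]; exact le_top
  have hb : topPressure T φ ≠ ⊥ := fun hb => by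
    have := hZ 1 le_rfl
    rw [hb, le_bot_iff] at this
    exact EReal.coe_ne_bot _ this
  obtain ⟨p, hpt⟩ : ∃ p : ℝ, topPressure T φ = p := ⟨_, (EReal.coe_toReal hT hb).symm⟩
  rw [hpt] at hZ ⊢
  have hp : ∀ m, 1 ≤ m → Real.log (partitionSum T φ m) ≤ p * (m + k) + C * k := by
    intro m hm
    have hm0 : (1 : ℝ) ≤ m := by exact_mod_cast hm
    have := EReal.coe_le_coe_iff.1 (hZ m hm)
    rw [div_le_iff₀ (by positivity)] at this
    linarith
  have hent : ∀ M : ℕ, 1 ≤ M →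
      entropy μ (shift T) ≤ ((p - (∫ x, φ M x ∂μ) / M : ℝ) : EReal) := fun M hM =>
    iSup_le fun r => iSup₂_le fun f hf => hφ.partitionEntropy_le h0 hC hp hinv hf hM
  rcases eq_or_ne (entropy μ (shift T)) ⊥ with he | he
  · rw [he, EReal.bot_add]; exact bot_le
  have het : entropy μ (shift T) ≠ ⊤ := ne_top_of_le_ne_top (EReal.coe_ne_top _) (hent 1 le_rfl)
  obtain ⟨h, hh⟩ : ∃ h : ℝ, entropy μ (shift T) = h := ⟨_, (EReal.coe_toReal het he).symm⟩
  -- With the entropy known to be a real `h`, it can be moved across, and the bounds for all `M`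
  -- become a bound on their supremum.
  have hle : asymptoticAverage T φ μ ≤ ((p - h : ℝ) : EReal) := by
    rw [havg]
    refine iSup₂_le fun M hM => EReal.coe_le_coe_iff.2 ?_
    have := hent M hM
    rw [hh] at this
    have := EReal.coe_le_coe_iff.1 this
    linarith
  calc entropy μ (shift T) + asymptoticAverage T φ μ ≤ (h : EReal) + ((p - h : ℝ) : EReal) :=
        add_le_add hh.le hle
    _ = p := by rw [← EReal.coe_add]; congr 1; ring

end Pressure

/-! ### Coding sequences of words by points of the shift space -/

/-- Sequences of admissible words of length `n` are coded by points of the shift space, with gaps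
of length `k` between consecutive words. -/
theorem HasConnections.exists_coding {k : ℕ} (hk : HasConnections T k) {n : ℕ} (hn : 1 ≤ n) :
    ∃ π : (ℕ → words T n) → shiftSpace T, Measurable π ∧
      (∀ ω, (shift T)^[n + k] (π ω) = π fun i => ω (i + 1)) ∧
      ∀ ω, initialWord n (π ω) = ω 0 := by
  classical
  choose c hc0 hc1 hc using hk
  -- One period: the word `a`, then the path from its last letter to the first letter of `b`. Index
  -- `n + k` already gives the first letter of `b`, so consecutive periods match.
  let e : words T n → words T n → ℕ → Fin q := fun a b r =>
    if h : r < n then a.1 ⟨r, h⟩ else c (a.1 ⟨n - 1, by omega⟩) (b.1 ⟨0, hn⟩) (r - (n - 1))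
  have he_path : ∀ a b r, n - 1 ≤ r →
      e a b r = c (a.1 ⟨n - 1, by omega⟩) (b.1 ⟨0, hn⟩) (r - (n - 1)) := by
    intro a b r hr
    by_cases h : r < n
    · obtain rfl : r = n - 1 := by omega
      simp only [e, dif_pos h, Nat.sub_self, hc0]
    · simp only [e, dif_neg h]
  have he_end : ∀ a b b', e a b (n + k) = e b b' 0 := by
    intro a b b'
    rw [he_path a b _ (by omega), show n + k - (n - 1) = k + 1 by omega, hc1]
    simp only [e, dif_pos (show 0 < n from hn)]
  have he_step : ∀ a b r, r < n + k → T (e a b r) (e a b (r + 1)) = 1 := by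
    intro a b r hr
    by_cases h : r + 1 < n
    · simp only [e, dif_pos h, dif_pos (show r < n by omega)]
      exact (Finset.mem_filter.1 a.2).2 r h
    · rw [he_path a b r (by omega), he_path a b (r + 1) (by omega),
        show r + 1 - (n - 1) = r - (n - 1) + 1 by omega]
      exact hc _ _ _ (by omega)
  have hN : 0 < n + k := by omega
  let x : (ℕ → words T n) → ℕ → Fin q := fun ω l =>
    e (ω (l / (n + k))) (ω (l / (n + k) + 1)) (l % (n + k))
  have hx : ∀ ω, x ω ∈ shiftSpace T := by
    intro ω l
    have hmod := Nat.mod_lt l hN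
    have hdm := Nat.div_add_mod' l (n + k)
    rcases (Nat.succ_le_of_lt hmod).lt_or_eq with h | h
    · have h1 : (l + 1) / (n + k) = l / (n + k) := by
        rw [Nat.div_eq_iff hN]; constructor <;> omega
      have h2 : (l + 1) % (n + k) = l % (n + k) + 1 := by
        have := Nat.div_add_mod' (l + 1) (n + k)
        rw [h1] at this; omega
      simp only [x, h1, h2]
      exact he_step _ _ _ hmod
    · have h0 : l + 1 = (l / (n + k) + 1) * (n + k) := by
        rw [add_mul, one_mul]; omega
      have h1 : (l + 1) / (n + k) = l / (n + k) + 1 := by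
        rw [h0, Nat.mul_div_cancel _ hN]
      have h2 : (l + 1) % (n + k) = 0 := by rw [h0, Nat.mul_mod_left]
      simp only [x, h1, h2]
      have := he_step (ω (l / (n + k))) (ω (l / (n + k) + 1)) _ hmod
      rwa [show l % (n + k) + 1 = n + k from h,
        he_end _ _ (ω (l / (n + k) + 1 + 1))] at this
  refine ⟨fun ω => ⟨x ω, hx ω⟩, ?_, fun ω => ?_, fun ω => ?_⟩
  · refine Measurable.subtype_mk (measurable_pi_lambda _ fun l => ?_)
    have hpair : Measurable fun ω : ℕ → words T n =>
        (ω (l / (n + k)), ω (l / (n + k) + 1)) := by fun_prop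
    exact (measurable_of_finite fun p : words T n × words T n => e p.1 p.2 (l % (n + k))).comp
      hpair
  · refine Subtype.ext (funext fun l => ?_)
    rw [shift_iterate_coord]
    simp only [x, Nat.add_div_right _ hN, Nat.add_mod_right]
  · funext j
    have h1 : (j : ℕ) < n + k := by omega
    change x ω j = _
    simp only [x, Nat.div_eq_of_lt h1, Nat.mod_eq_of_lt h1, e, dif_pos j.2]

/-! ### Averaging along a periodic orbit of measures -/

/-- The average of a cycle of measures is invariant. -/
theorem exists_invariant_average {X : Type*} [MeasurableSpace X] {S : X → X} (hS : Measurable S)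
    {N : ℕ} (hN : 1 ≤ N) {m : ℕ → Measure X} [∀ j, IsProbabilityMeasure (m j)]
    (hm : ∀ j, (m j).map S = m (j + 1)) (hcycle : m N = m 0) :
    ∃ μ : Measure X, IsProbabilityMeasure μ ∧ MeasurePreserving S μ μ ∧
      (∀ s, μ.real s = (∑ j ∈ Finset.range N, (m j).real s) / N) ∧
      ∀ g : X → ℝ, (∀ j, Integrable g (m j)) →
        ∫ x, g x ∂μ = (∑ j ∈ Finset.range N, ∫ x, g x ∂(m j)) / N := by
  have hN0 : (N : ENNReal) ≠ 0 := by exact_mod_cast (show N ≠ 0 by omega)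
  have happ : ∀ s, ((N : ENNReal)⁻¹ • ∑ j ∈ Finset.range N, m j) s =
      (N : ENNReal)⁻¹ * ∑ j ∈ Finset.range N, m j s := fun s => by
    rw [Measure.smul_apply, Measure.finsetSum_apply, smul_eq_mul]
  refine ⟨(N : ENNReal)⁻¹ • ∑ j ∈ Finset.range N, m j, ⟨?_⟩, ⟨hS, ?_⟩, fun s => ?_, fun g hg => ?_⟩
  · rw [happ]
    simp [ENNReal.inv_mul_cancel hN0 (ENNReal.natCast_ne_top N)]
  · ext s hs
    rw [Measure.map_apply hS hs, happ, happ]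
    congr 1
    have h1 : ∀ j, m j (S ⁻¹' s) = m (j + 1) s := fun j => by rw [← hm, Measure.map_apply hS hs]
    simp only [h1]
    obtain ⟨N, rfl⟩ : ∃ N', N = N' + 1 := ⟨N - 1, by omega⟩
    rw [Finset.sum_range_succ, Finset.sum_range_succ' (fun j => m j s), hcycle]
  · rw [measureReal_def, happ, ENNReal.toReal_mul, ENNReal.toReal_inv, ENNReal.toReal_natCast,
      ENNReal.toReal_sum fun j _ => measure_ne_top _ _, div_eq_inv_mul]
    rfl
  · rw [integral_smul_measure, integral_finsetSum_measure fun j _ => hg j, ENNReal.toReal_inv,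
      ENNReal.toReal_natCast, smul_eq_mul, div_eq_inv_mul]

theorem shannonEntropy_map {X Y A : Type*} [MeasurableSpace X] [MeasurableSpace Y] [Fintype A]
    [MeasurableSpace A] [MeasurableSingletonClass A] {μ : Measure X} {h : X → Y}
    (hh : Measurable h) {f : Y → A} (hf : Measurable f) :
    shannonEntropy (μ.map h) f = shannonEntropy μ (fun x => f (h x)) := by
  refine Finset.sum_congr rfl fun a _ => ?_
  rw [map_measureReal_apply hh (hf (measurableSet_singleton a))]
  rfl

/-! ### Invariant measures almost attaining the topological pressure -/

/-- For each `n` some invariant measure has free energy at least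
`(log Z_n - C k) / (n + k)`, where `Z_n` is the `n`-th partition sum. -/
theorem IsSuperadditive.exists_invariant_free_energy_ge {φ : ℕ → shiftSpace T → ℝ}
    (hφ : IsSuperadditive T φ) (h0 : φ 0 = 0) [Nonempty (shiftSpace T)] {k : ℕ}
    (hk : HasConnections T k) {C : ℝ} (hC : ∀ n x, -(C * n) ≤ φ n x) {n : ℕ} (hn : 1 ≤ n) :
    ∃ μ ∈ invariantMeasures T,
      (((Real.log (partitionSum T φ n) - C * k) / (n + k) : ℝ) : EReal) ≤
        entropy μ (shift T) + asymptoticAverage T φ μ := by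
  obtain ⟨π, hπm, hπs, hπ0⟩ := hk.exists_coding hn
  set N := n + k with hNdef
  have hN : 1 ≤ N := by omega
  have hN0 : (0 : ℝ) < N := by exact_mod_cast hN
  have hπi : ∀ (i : ℕ) ω, (shift T)^[i * N] (π ω) = π fun l => ω (l + i) := by
    intro i
    induction i with
    | zero => intro ω; simp
    | succ i ih =>
      intro ω
      rw [show (i + 1) * N = i * N + N by ring, Function.iterate_add_apply, hπs, ih]
      rfl
  have hword : ∀ (i : ℕ) ω, initialWord n ((shift T)^[i * N] (π ω)) = ω i := fun i ω => by
    rw [hπi, hπ0, Nat.zero_add]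
  have hZ := partitionSum_pos (φ := φ) n
  set Z := partitionSum T φ n with hZdef
  -- The Gibbs weights, for which entropy plus mean energy is exactly `log Z`.
  let p : words T n → ℝ := fun a => Real.exp (cylinderInf φ n a) / Z
  have hpsum : ∑ a, p a = 1 := by
    rw [← Finset.sum_div, Finset.sum_coe_sort (words T n) fun w => Real.exp (cylinderInf φ n w)]
    exact div_self hZ.ne'
  obtain ⟨P, hP, hPp⟩ := exists_isProbabilityMeasure_real_singleton
    (fun a => (show 0 ≤ p a by positivity)) hpsum
  set H := shannonEntropy P (fun a => a) with hH
  set α := ∫ a, cylinderInf φ n a.1 ∂P with hα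
  have hHα : H + α = Real.log Z := by
    have h1 : α = ∑ a, p a * cylinderInf φ n a.1 := by
      rw [hα, ← sum_measureReal_preimage_mul measurable_id' (fun a : words T n =>
        cylinderInf φ n a.1)]
      exact Finset.sum_congr rfl fun a _ => by rw [Set.preimage_id', hPp]
    have h2 : H = ∑ a, (p a * Real.log Z - p a * cylinderInf φ n a.1) := by
      refine Finset.sum_congr rfl fun a _ => ?_
      rw [Set.preimage_id', hPp, Real.negMulLog]
      have : Real.log (p a) = cylinderInf φ n a - Real.log Z := by
        rw [Real.log_div (Real.exp_pos _).ne' hZ.ne', Real.log_exp]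
      rw [this]
      ring
    rw [h2, h1, Finset.sum_sub_distrib, ← Finset.sum_mul, hpsum]
    ring
  set Q := Measure.infinitePi fun _ : ℕ => P with hQ
  have hτm : Measurable fun (ω : ℕ → words T n) (i : ℕ) => ω (i + 1) := by fun_prop
  have hQshift : Q.map (fun ω i => ω (i + 1)) = Q :=
    Measure.map_infinitePi_infinitePi_of_inj (P := fun _ : ℕ => P) (add_left_injective 1)
  have hmj : ∀ j : ℕ, Measurable fun ω => (shift T)^[j] (π ω) := fun j =>
    (measurable_shift.iterate j).comp hπm
  let m : ℕ → Measure (shiftSpace T) := fun j => Q.map fun ω => (shift T)^[j] (π ω)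
  have hmp : ∀ j, IsProbabilityMeasure (m j) := fun j =>
    Measure.isProbabilityMeasure_map (hmj j).aemeasurable
  obtain ⟨μ, hμp, hμinv, hμreal, hμint⟩ := exists_invariant_average (m := m)
    (measurable_shift (T := T)) hN
    (fun j => by
      rw [Measure.map_map measurable_shift (hmj j)]
      simp only [m, Function.iterate_succ_apply']
      rfl)
    (by
      -- `N` shifts of the coded point amount to one shift of the word sequence, which preserves
      -- `Q`; so the laws `m j` cycle with period `N`.
      simp only [m, hπs]
      conv_rhs => rw [← hQshift, Measure.map_map (hmj 0) hτm]
      rfl)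
  have hμ : μ ∈ invariantMeasures T := ⟨hμp, hμinv⟩
  refine ⟨μ, hμ, ?_⟩
  have hH0 : 0 ≤ H := shannonEntropy_nonneg
  have hent : ((H / N : ℝ) : EReal) ≤ entropy μ (shift T) := by
    refine le_trans ?_ (le_iSup_of_le q (le_iSup₂_of_le (fun x : shiftSpace T => x.1 0)
      (measurable_coord 0) le_rfl))
    have hbound : ∀ l : ℕ, (l / N - 2) * H ≤ shannonEntropy μ (initialWord l) := by
      intro l
      -- After `j < N` shifts the word with index `0` may be cut, so only words `1, …, t` are read
      -- off from `l` letters; truncated subtraction covers `l < N`.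
      set t := l / N - 1 with ht
      have hj : ∀ j ∈ Finset.range N, t * H ≤ shannonEntropy (m j) (initialWord l) := by
        intro j hj
        rw [Finset.mem_range] at hj
        rw [shannonEntropy_map (hmj j) (measurable_initialWord l), hH,
          ← shannonEntropy_infinitePi P 1 t]
        refine shannonEntropy_le_of_factors ((measurable_initialWord l).comp (hmj j))
          (by fun_prop) fun ω ω' h => funext fun i => ?_
        rw [initialWord_eq_iff] at h
        rw [← Subtype.coe_inj, ← hword, ← hword]
        refine initialWord_eq_iff.2 fun r hr => ?_
        have hi := i.2
        have h1 : (1 + (i : ℕ) + 1) * N ≤ l :=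
          (Nat.mul_le_mul_right N (show 1 + (i : ℕ) + 1 ≤ l / N by omega)).trans
            (Nat.div_mul_le_self l N)
        have h2 : (1 + (i : ℕ)) * N = N + i * N := by ring
        have h3 : (1 + (i : ℕ) + 1) * N = N + i * N + N := by ring
        have := h (r + (1 + i) * N - j) (by omega)
        rw [shift_iterate_coord, shift_iterate_coord] at this ⊢
        rwa [show r + (1 + i) * N - j + j = r + (1 + i) * N by omega] at this
      have h1 := sum_shannonEntropy_le_of_average hN (f := initialWord l)
        fun a => hμreal (initialWord l ⁻¹' {a})
      have h2 := Finset.card_nsmul_le_sum _ _ _ hj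
      rw [Finset.card_range, nsmul_eq_mul] at h2
      have h3 : t * H ≤ shannonEntropy μ (initialWord l) :=
        le_of_mul_le_mul_left (h2.trans h1) hN0
      refine le_trans (mul_le_mul_of_nonneg_right ?_ hH0) h3
      have h4 : (l : ℝ) / N < (l / N : ℕ) + 1 := by
        rw [div_lt_iff₀ hN0]
        exact_mod_cast Nat.lt_mul_of_div_lt (Nat.lt_succ_self _) hN
      have h5 : ((l / N : ℕ) : ℝ) ≤ t + 1 := by exact_mod_cast (show l / N ≤ t + 1 by omega)
      linarith
    have hlim : Tendsto (fun l : ℕ => ((H / N - 2 * H / l : ℝ) : EReal)) atTop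
        (𝓝 ((H / N : ℝ) : EReal)) := by
      refine (continuous_coe_real_ereal.tendsto _).comp ?_
      simpa using tendsto_const_nhds.sub (tendsto_const_div_atTop_nhds_zero_nat (2 * H))
    rw [← hlim.limsup_eq]
    refine limsup_le_limsup ?_
    filter_upwards [eventually_ge_atTop 1] with l hl
    have hl0 : (0 : ℝ) < l := by exact_mod_cast hl
    refine EReal.coe_le_coe_iff.2 ?_
    rw [itinerary_zero_coord, le_div_iff₀ hl0]
    refine le_trans (le_of_eq ?_) (hbound l)
    field_simp
  have havg : (((α - C * k) / N : ℝ) : EReal) ≤ asymptoticAverage T φ μ := by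
    have hA : asymptoticAverage T φ μ = _ := (hφ.tendsto_averageSeq h0 hμ).limsup_eq
    -- Starting at phase `j`, the orbit segment splits into `N - j` steps, `t` full periods and `j`
    -- steps; the two ends together cost `C * N`, and each period costs `C * k` for its gap.
    have hbound : ∀ t : ℕ, t * (α - C * k) - C * N ≤ ∫ x, φ ((t + 1) * N) x ∂μ := by
      intro t
      rw [hμint _ fun j => hφ.integrable h0 (m j) _, le_div_iff₀ hN0]
      have hj : ∀ j ∈ Finset.range N, t * (α - C * k) - C * N ≤
          ∫ x, φ ((t + 1) * N) x ∂(m j) := by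
        intro j hj
        rw [Finset.mem_range] at hj
        have hcoord : ∀ i : ℕ, Measurable fun ω : ℕ → words T n => ω (i + 1) := fun i => by
          fun_prop
        have hi : ∀ i ∈ Finset.range t,
            Integrable (fun ω : ℕ → words T n => cylinderInf φ n (ω (i + 1)).1) Q := fun i _ =>
          integrable_comp_of_finite (hcoord i)
            (fun a : words T n => cylinderInf φ n a.1)
        have h1 : ∫ ω, (∑ i ∈ Finset.range t, cylinderInf φ n (ω (i + 1)).1 -
            (t * (C * k) + C * N)) ∂Q = t * (α - C * k) - C * N := by
          rw [integral_sub (integrable_finsetSum _ hi) (integrable_const _),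
            integral_finsetSum _ hi]
          have : ∀ i, ∫ ω, cylinderInf φ n (ω (i + 1)).1 ∂Q = α := fun i =>
            integral_comp_of_measurePreserving
              (measurePreserving_eval_infinitePi (fun _ : ℕ => P) (i + 1))
              (F := fun a => cylinderInf φ n a.1)
              (measurable_of_finite _).aestronglyMeasurable
          simp only [this, Finset.sum_const, Finset.card_range, nsmul_eq_mul, integral_const,
            probReal_univ, one_smul]
          ring
        rw [integral_map (hmj j).aemeasurable (hφ.integrable h0 (m j) _).aestronglyMeasurable,
          ← h1]
        refine integral_mono ((integrable_finsetSum _ hi).sub (integrable_const _))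
          ((hφ.integrable h0 (m j) _).comp_measurable (hmj j)) fun ω => ?_
        have a1 := hφ.superadd_of_zero h0 (N - j) (t * N + j) ((shift T)^[j] (π ω))
        rw [← Function.iterate_add_apply, Nat.sub_add_cancel hj.le, show N - j + (t * N + j) =
          (t + 1) * N by rw [add_mul, one_mul]; omega] at a1
        have a2 := hφ.sum_le h0 N j t ((shift T)^[N] (π ω))
        have a3 := hC (N - j) ((shift T)^[j] (π ω))
        have a4 := hC j ((shift T)^[t * N] ((shift T)^[N] (π ω)))
        have a5 : ∑ i ∈ Finset.range t, (cylinderInf φ n (ω (i + 1)).1 - C * k) ≤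
            ∑ i ∈ Finset.range t, φ N ((shift T)^[i * N] ((shift T)^[N] (π ω))) := by
          refine Finset.sum_le_sum fun i _ => ?_
          rw [← Function.iterate_add_apply, show i * N + N = (i + 1) * N by ring]
          have b1 := cylinderInf_initialWord_le hC n ((shift T)^[(i + 1) * N] (π ω))
          rw [hword] at b1
          have b2 := hφ.superadd_of_zero h0 n k ((shift T)^[(i + 1) * N] (π ω))
          have b3 := hC k ((shift T)^[n] ((shift T)^[(i + 1) * N] (π ω)))
          linarith
        rw [Finset.sum_sub_distrib, Finset.sum_const, Finset.card_range, nsmul_eq_mul] at a5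
        rw [Nat.cast_sub hj.le] at a3
        change _ ≤ φ ((t + 1) * N) ((shift T)^[j] (π ω))
        linarith
      have h2 := Finset.card_nsmul_le_sum _ _ _ hj
      rw [Finset.card_range, nsmul_eq_mul] at h2
      linarith
    have hlim : Tendsto (fun t : ℕ => (((α - C * k) / N -
        (α - C * k + C * N) / N * (1 / ((t : ℝ) + 1)) : ℝ) : EReal)) atTop
        (𝓝 (((α - C * k) / N : ℝ) : EReal)) := by
      refine (continuous_coe_real_ereal.tendsto _).comp ?_
      simpa using tendsto_const_nhds.sub
        (tendsto_one_div_add_atTop_nhds_zero_nat.const_mul ((α - C * k + C * N) / N))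
    -- Lengths that are multiples of `N` suffice, because the asymptotic average is a supremum over
    -- all lengths.
    refine le_of_tendsto' hlim fun t => ?_
    rw [hA]
    refine le_iSup₂_of_le ((t + 1) * N) (Nat.mul_pos (Nat.succ_pos t) hN) ?_
    refine EReal.coe_le_coe_iff.2 ?_
    push_cast
    rw [le_div_iff₀ (by positivity)]
    refine le_trans (le_of_eq ?_) (hbound t)
    field_simp
    ring
  refine le_trans (le_of_eq ?_) (add_le_add hent havg)
  rw [← EReal.coe_add, ← add_div, ← add_sub_assoc, hHα, hNdef]
  push_cast
  rfl

/-! ### Normalisation at index zero and conclusion -/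

/-- Changing the value of the sequence at `0` so that it vanishes there. -/
theorem IsSuperadditive.update_zero {φ : ℕ → shiftSpace T → ℝ} (hφ : IsSuperadditive T φ) :
    IsSuperadditive T (Function.update φ 0 0) where
  continuous n hn := by
    rw [Function.update_of_ne (by omega)]
    exact hφ.continuous n hn
  superadd n m hn hm x := by
    rw [Function.update_of_ne (by omega), Function.update_of_ne (by omega),
      Function.update_of_ne (by omega)]
    exact hφ.superadd n m hn hm x

/-- At `n = 0` the division by zero gives `0` whatever `φ 0` is, so equality holds at every index.
-/
theorem averageSeq_update_zero (φ : ℕ → shiftSpace T → ℝ) (μ : Measure (shiftSpace T)) :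
    averageSeq T (Function.update φ 0 0) μ = averageSeq T φ μ := by
  funext n
  rcases Nat.eq_zero_or_pos n with rfl | hn
  · simp [averageSeq]
  · simp only [averageSeq, Function.update_of_ne hn.ne']

theorem pressureSeq_update_zero (φ : ℕ → shiftSpace T → ℝ) :
    pressureSeq T (Function.update φ 0 0) = pressureSeq T φ := by
  funext n
  rcases Nat.eq_zero_or_pos n with rfl | hn
  · simp [pressureSeq]
  · simp only [pressureSeq, partitionSum, Function.update_of_ne hn.ne']

/-- The variational principle for sequences vanishing at `0`. -/
theorem IsSuperadditive.topPressure_eq_measPressure {φ : ℕ → shiftSpace T → ℝ}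
    (hφ : IsSuperadditive T φ) (h0 : φ 0 = 0) [Nonempty (shiftSpace T)] {k : ℕ}
    (hk : HasConnections T k) : topPressure T φ = measPressure T φ := by
  refine le_antisymm ?_ (iSup₂_le fun μ hμ => hφ.entropy_add_asymptoticAverage_le h0 hk hμ)
  obtain ⟨C, -, hC⟩ := hφ.exists_lower_bound h0
  rw [topPressure, (hφ.tendsto_pressureSeq h0 hk hC).limsup_eq]
  refine iSup₂_le fun n hn => ?_
  obtain ⟨μ, hμ, h⟩ := hφ.exists_invariant_free_energy_ge h0 hk hC hn
  exact le_iSup₂_of_le μ hμ h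

end SFT

theorem mainTheorem4 (q : ℕ) (hq : 1 ≤ q) (T : Matrix (Fin q) (Fin q) ℤ)
    (hT01 : ∀ i j, T i j = 0 ∨ T i j = 1) (hT : T.IsPrimitive)
    (φ : ℕ → SFT.shiftSpace T → ℝ) (hφ : SFT.IsSuperadditive T φ) :
    -- the limits defining `Φ_*(μ)` and the topological pressure exist in `[-∞, ∞]`
    (∀ μ ∈ SFT.invariantMeasures T,
      Tendsto (SFT.averageSeq T φ μ) atTop (𝓝 (SFT.asymptoticAverage T φ μ))) ∧
    Tendsto (SFT.pressureSeq T φ) atTop (𝓝 (SFT.topPressure T φ)) ∧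
    -- the variational principle
    SFT.topPressure T φ = SFT.measPressure T φ := by
  obtain ⟨k, hk⟩ := SFT.exists_hasConnections hT01 hT
  have hne := SFT.nonempty_shiftSpace hq hk
  have h0 : Function.update φ 0 0 0 = (0 : SFT.shiftSpace T → ℝ) := Function.update_self ..
  have hψ := hφ.update_zero
  obtain ⟨C, -, hC⟩ := hψ.exists_lower_bound h0
  refine ⟨fun μ hμ => ?_, ?_, ?_⟩
  · have h := hψ.tendsto_averageSeq h0 hμ
    rw [SFT.averageSeq_update_zero] at h
    rwa [SFT.asymptoticAverage, h.limsup_eq]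
  · have h := hψ.tendsto_pressureSeq h0 hk hC
    rw [SFT.pressureSeq_update_zero] at h
    rwa [SFT.topPressure, h.limsup_eq]
  · have h := hψ.topPressure_eq_measPressure h0 hk
    simpa only [SFT.topPressure, SFT.measPressure, SFT.asymptoticAverage,
      SFT.pressureSeq_update_zero, SFT.averageSeq_update_zero] using h
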